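/- **Setting.** Let $(\mathbb X,\rho)$ be a quasi-metric space (symmetric $\rho$, quasi-triangle inequality with a constant $\kappa\ge1$) with the topology given by $\rho$, and $\mu$ a Borel probability measure on it. Let $\{\varphi_k\}_{k\ge0}$ be an orthonormal basis of real $L_2(\mathbb X,\mu)$ consisting of continuous real functions, $\varphi_0\equiv1$, and let $0=\lambda_0\le\lambda_1\le\dots\to\infty$. Put $G_t(x,y)=\sum_k e^{-\lambda_k^2t}\varphi_k(x)\varphi_k(y)$. Let $\alpha>0$ and assume that $\mathbb X$ is a diffusion measure space with exponent $\alpha$: with $B_t(x)=\{y:\rho(x,y)\le t\}$ there are constants $c_0,C_0>0$ such that for all $x,y\in\mathbb X$: $B_t(x)$ is compact and $\mu(B_t(x))\le C_0t^\alpha$ for $t>0$; $|G_t(x,y)|\le C_0t^{-\alpha/2}\exp(-c_0\rho(x,y)^2/t)$ for $0<t\le1$; $G_t(x,x)\ge c_0t^{-\alpha/2}$ for $0<t<1$. Throughout, $N$ runs through the powers $2^n$, $n=0,1,2,\dots$. Let $\Pi_N=\operatorname{span}\{\varphi_k:\lambda_k\le N\}$ (for every real $N$). Assume the strong product assumption and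 fix $a>0$ such that $fg\in\Pi_{aN}$ for all $N$, $f\in\Pi_N$, $g\in\Pi_{2N}$ (such an $a$ exists if and only if, for some $a_0>0$, $fg\in\Pi_{a_0N}$ for all $N$ and all $f,g\in\Pi_N$). Let $1\le p\le\infty$. A uniform family of Marcinkiewicz–Zygmund quadrature measures is a family $(\nu_N)$ of signed Borel measures with $\int f\,d\nu_N=\int f\,d\mu$ and $A_1\|f\|_{L_p(\mu)}\le\|f\|_{L_p(|\nu_N|)}\le A_2\|f\|_{L_p(\mu)}$ for all $f\in\Pi_{aN}$ and all $N$, with constants $A_1,A_2>0$ independent of $f$ and $N$, and, if $p=\infty$, also $\|f\|_{L_1(|\nu_N|)}\le A\|f\|_{L_1(\mu)}$ for all such $f$ and $N$, with a constant $A$. Let $X_p(\mathbb X)$ be the $L_p(\mu)$-closure of $\bigcup_N\Pi_N$ (consisting of continuous functions if $p=\infty$). Let $C^\infty(\mathbb X)$ be the set of continuous $f$ with $\sup_N N^t\inf_{g\in\Pi_N}\|f-g\|_{L_\infty}<\infty$ for every $t>0$. Assume the smooth cut-off property: for any two concentric balls $B'=B_{R'}(x)\subsetneq B=B_R(x)$,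 $R',R>0$, there is $\phi\in C^\infty(\mathbb X)$ with $\phi=1$ on $B'$ and $\phi=0$ outside $B$. Let $H:[0,\infty)\to\mathbb R$ be smooth and non-increasing with $H=1$ on $[0,1/2]$ and $H=0$ on $[1,\infty)$. For a signed measure $\nu$ put $\sigma_N(f,\nu,x)=\sum_kH(\lambda_k/N)\int f\varphi_k\,d\nu\;\varphi_k(x)$. If $p=\infty$ let $(\mu_N)$ be a uniform family of Marcinkiewicz–Zygmund quadrature measures; if $p<\infty$ let $\mu_N=\mu$ for all $N$. Let $(\nu_N)$ be a uniform family of Marcinkiewicz–Zygmund quadrature measures whose supports are finite with $\#\operatorname{supp}\nu_N\le C_1N^\alpha$, $C_1$ independent of $N$. Let $s>0$, $S>\max(1,s)$, let $B'\subsetneq B$ be concentric balls of positive radii, and for $r>0$ let $\overline{W^s_r}(L_p(\mathbb X),B)$ be the set of all $f\in X_p(\mathbb X)$ with $$\|f\|_{L_p(\mathbb X)}+\sup_{N\ge2}N^s\|\sigma_N(f,\mu_N)-\sigma_{N/2}(f,\mu_{N/2})\|_{L_p(B)}\le r.$$ Put $I_N(f,\mu_N,y)=\lfloor N^S\sigma_N(f,\mu_N,y)\rfloor$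 and $$\sigma_N^\circ(f,\mu_N,\nu_N,B)=N^{-S}\sum_kH\big(\tfrac{\lambda_k}{2N}\big)\int_BI_N(f,\mu_N,y)\varphi_k(y)\,d\nu_N(y)\;\varphi_k .$$ **Theorem.** For every $r_0>0$ there is a constant $c>0$ such that the following two statements hold. 1. For all $r\ge r_0$, all $N$ and all $f\in\overline{W^s_r}(L_p(\mathbb X),B)$, $$\|f-\sigma^\circ_N(f,\mu_N,\nu_N,B)\|_{L_p(B')}\le c\,r\,N^{-s}.$$ 2. There is a constant $C>0$ such that for all $r>0$, all $N$ and $\varepsilon=crN^{-s}$ with $\varepsilon\le1$ and $\varepsilon\le r$, the number of bits needed to represent all the integers $\{I_N(f,\mu_N,y):y\in\operatorname{supp}(\nu_N)\cap B\}$ is at most $$C\,(r/\varepsilon)^{\alpha/s}\,(1+\log_2(r/\varepsilon)).$$ More precisely, all these integers, for all $f\in\overline{W^s_r}(L_p(\mathbb X),B)$, can be written as signed binary words of one common length $w$ (depending on $r$ and $N$ only), and $w\cdot\#(\operatorname{supp}(\nu_N)\cap B)$ does not exceed this bound. -/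

import Mathlib

open MeasureTheory Filter Topology
open scoped ENNReal

namespace DiffusionSpace

noncomputable section

/-- The closed ball of radius `t` around `x` for the quasi-metric `ρ`. -/
def qBall {X : Type*} (ρ : X → X → ℝ) (x : X) (t : ℝ) : Set X := {y | ρ x y ≤ t}

/-- `ρ` is a quasi-metric on `X` and the topology of `X` is the one given by `ρ`. -/
structure IsQuasiMetric {X : Type*} [TopologicalSpace X] (ρ : X → X → ℝ) : Prop where
  nonneg : ∀ x y, 0 ≤ ρ x y
  eq_zero_iff : ∀ x y, ρ x y = 0 ↔ x = y
  symm : ∀ x y, ρ x y = ρ y x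
  quasi_triangle : ∃ κ : ℝ, 1 ≤ κ ∧ ∀ x y z, ρ x z ≤ κ * (ρ x y + ρ y z)
  nhds_basis : ∀ x, (𝓝 x).HasBasis (fun t : ℝ => 0 < t) (fun t => {y | ρ x y < t})

/-- The generalized heat kernel `G_t(x,y) = ∑ₖ exp(-λₖ² t) φₖ(x) φₖ(y)`. -/
def heatKernel {X : Type*} (φ : ℕ → X → ℝ) (ev : ℕ → ℝ) (t : ℝ) (x y : X) : ℝ :=
  ∑' k, Real.exp (-(ev k) ^ 2 * t) * φ k x * φ k y

/-- `X` with quasi-metric `ρ`, Borel probability measure `μ`, orthonormal basis `φ` of `L₂(μ)`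
made of continuous functions and numbers `ev k = λₖ` is a diffusion measure space
with exponent `α`. -/
structure IsDiffusionMeasureSpace {X : Type*} [TopologicalSpace X] [MeasurableSpace X]
    [BorelSpace X] (ρ : X → X → ℝ) (μ : Measure X) [IsProbabilityMeasure μ] (φ : ℕ → X → ℝ)
    (ev : ℕ → ℝ) (α : ℝ) : Prop where
  isQuasiMetric : IsQuasiMetric ρ
  continuous : ∀ k, Continuous (φ k)
  hilbertBasis : ∃ b : HilbertBasis ℕ ℝ (Lp ℝ 2 μ), ∀ k, (b k : X → ℝ) =ᵐ[μ] φ k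
  φ_zero : ∀ x, φ 0 x = 1
  ev_zero : ev 0 = 0
  ev_mono : Monotone ev
  ev_tendsto : Tendsto ev atTop atTop
  α_pos : 0 < α
  compact_ball : ∀ x t, 0 < t → IsCompact (qBall ρ x t)
  volume_le : ∃ C : ℝ, 0 < C ∧ ∀ x t, 0 < t → μ.real (qBall ρ x t) ≤ C * t ^ α
  heat_upper : ∃ c C : ℝ, 0 < c ∧ 0 < C ∧ ∀ x y t, 0 < t → t ≤ 1 →
    |heatKernel φ ev t x y| ≤ C * t ^ (-α / 2) * Real.exp (-c * (ρ x y ^ 2 / t))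
  heat_lower : ∃ c : ℝ, 0 < c ∧ ∀ x t, 0 < t → t < 1 → c * t ^ (-α / 2) ≤ heatKernel φ ev t x x

/-- The diffusion polynomials `Π_N = span {φₖ : λₖ ≤ N}`. -/
def diffPoly {X : Type*} (φ : ℕ → X → ℝ) (ev : ℕ → ℝ) (N : ℝ) : Submodule ℝ (X → ℝ) :=
  Submodule.span ℝ (φ '' {k | ev k ≤ N})

/-- `a` is an admissible constant in the strong product assumption: products of elements of
`Π_N` and `Π_{2N}` lie in `Π_{aN}`, for `N = 2ⁿ`. Such an `a` exists if and only if there is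
`a₀ > 0` with `Π_N · Π_N ⊆ Π_{a₀N}` for all `N = 2ⁿ` (take `a = 2 a₀`). -/
def StrongProduct {X : Type*} (φ : ℕ → X → ℝ) (ev : ℕ → ℝ) (a : ℝ) : Prop :=
  0 < a ∧ ∀ n : ℕ, ∀ f ∈ diffPoly φ ev (2 ^ n), ∀ g ∈ diffPoly φ ev (2 * 2 ^ n),
    f * g ∈ diffPoly φ ev (a * 2 ^ n)

/-- The signed measure `ν` is a quadrature measure of order `N`. -/
def IsQuadrature {X : Type*} [MeasurableSpace X] (μ : Measure X) (φ : ℕ → X → ℝ) (ev : ℕ → ℝ)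
    (a N : ℝ) (ν : SignedMeasure X) : Prop :=
  ∀ f ∈ diffPoly φ ev (a * N), ∫ᵛ x, f x ∂<•ν = ∫ x, f x ∂μ

/-- A uniform family of Marcinkiewicz-Zygmund quadrature measures for the exponent `p`;
`ν n` is the member of order `N = 2ⁿ`, and `(ν n).variation` is its total variation measure.
For `p = ∞` the two-sided inequality does not see the size of `|ν|`, and one also asks for the
upper inequality with the exponent `1` (for `p < ∞` it is a consequence). -/
structure IsUniformMZQuadrature {X : Type*} [MeasurableSpace X] (μ : Measure X)
    (φ : ℕ → X → ℝ) (ev : ℕ → ℝ) (a : ℝ) (p : ℝ≥0∞) (ν : ℕ → SignedMeasure X) : Prop where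
  quadrature : ∀ n, IsQuadrature μ φ ev a (2 ^ n) (ν n)
  mz : ∃ A₁ A₂ : ℝ, 0 < A₁ ∧ 0 < A₂ ∧ ∀ n, ∀ f ∈ diffPoly φ ev (a * 2 ^ n),
    ENNReal.ofReal A₁ * eLpNorm f p μ ≤ eLpNorm f p (ν n).variation ∧
    eLpNorm f p (ν n).variation ≤ ENNReal.ofReal A₂ * eLpNorm f p μ
  mz_one : p = ∞ → ∃ A : ℝ, 0 < A ∧ ∀ n, ∀ f ∈ diffPoly φ ev (a * 2 ^ n),
    eLpNorm f 1 (ν n).variation ≤ ENNReal.ofReal A * eLpNorm f 1 μ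

/-- `#supp(ν_N) ≲ N^α` for `N = 2ⁿ`. -/
def SupportGrowth {X : Type*} [TopologicalSpace X] [MeasurableSpace X] (α : ℝ)
    (ν : ℕ → SignedMeasure X) : Prop :=
  ∃ C : ℝ, 0 < C ∧ ∀ n : ℕ, (ν n).variation.support.Finite ∧
    ((ν n).variation.support.ncard : ℝ) ≤ C * ((2 : ℝ) ^ n) ^ α

/-- A low-pass filter (only the values on `[0, ∞)` matter). -/
structure IsLowPass (H : ℝ → ℝ) : Prop where
  smooth : ContDiffOn ℝ ((⊤ : ℕ∞) : WithTop ℕ∞) H (Set.Ici 0)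
  antitone : AntitoneOn H (Set.Ici 0)
  eq_one : ∀ t, 0 ≤ t → t ≤ 1 / 2 → H t = 1
  eq_zero : ∀ t, 1 ≤ t → H t = 0

/-- `σ_N(f, ν)(x) = ∑ₖ H(λₖ / N) (∫ f φₖ dν) φₖ(x)`. -/
def sigma {X : Type*} [MeasurableSpace X] (φ : ℕ → X → ℝ) (ev : ℕ → ℝ) (H : ℝ → ℝ) (N : ℝ)
    (f : X → ℝ) (ν : SignedMeasure X) (x : X) : ℝ :=
  ∑' k, H (ev k / N) * (∫ᵛ y, f y * φ k y ∂<•ν) * φ k x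

/-- `X_p`: the `L_p(μ)`-closure of the diffusion polynomials. For `p = ∞` its elements have
continuous representatives (uniform limits of diffusion polynomials), and these are the ones
that are evaluated at points. -/
def MemX {X : Type*} [TopologicalSpace X] [MeasurableSpace X] (μ : Measure X)
    (φ : ℕ → X → ℝ) (ev : ℕ → ℝ) (p : ℝ≥0∞) (f : X → ℝ) : Prop :=
  MemLp f p μ ∧ (p = ∞ → Continuous f) ∧
    ∀ δ : ℝ≥0∞, 0 < δ → ∃ N : ℝ, ∃ g ∈ diffPoly φ ev N, eLpNorm (f - g) p μ ≤ δ

/-- The global Sobolev norm `‖f‖_{L_p} + sup_N N^s E(f, Π_N, L_p)`, with `N = 2ⁿ`. -/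
def sobolevNorm {X : Type*} [MeasurableSpace X] (μ : Measure X) (φ : ℕ → X → ℝ) (ev : ℕ → ℝ)
    (s : ℝ) (p : ℝ≥0∞) (f : X → ℝ) : ℝ≥0∞ :=
  eLpNorm f p μ + ⨆ n : ℕ, ENNReal.ofReal (((2 : ℝ) ^ n) ^ s) *
    ⨅ g ∈ diffPoly φ ev (2 ^ n), eLpNorm (f - g) p μ

/-- `C^∞(X) = ⋂_{s > 0} W^s(L_∞(X))`, as a set of continuous functions. -/
def smoothFunctions {X : Type*} [TopologicalSpace X] [MeasurableSpace X] (μ : Measure X)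
    (φ : ℕ → X → ℝ) (ev : ℕ → ℝ) : Set (X → ℝ) :=
  {f | Continuous f ∧ ∀ s : ℝ, 0 < s → sobolevNorm μ φ ev s ∞ f < ∞}

/-- The smooth cut-off property. -/
def SmoothCutoff {X : Type*} [TopologicalSpace X] [MeasurableSpace X] (ρ : X → X → ℝ)
    (μ : Measure X) (φ : ℕ → X → ℝ) (ev : ℕ → ℝ) : Prop :=
  ∀ (x : X) (R' R : ℝ), 0 < R' → 0 < R → qBall ρ x R' ⊂ qBall ρ x R →
    ∃ ψ ∈ smoothFunctions μ φ ev, (∀ y ∈ qBall ρ x R', ψ y = 1) ∧ ∀ y ∉ qBall ρ x R, ψ y = 0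

/-- The norm `‖f‖_{L_p(X)} + sup_N N^s ‖τ_N(f)‖_{L_p(B)}` of the local Sobolev space
`W^s(L_p(X), B)`, where `τ_N(f) = σ_N(f, μ_N) - σ_{N/2}(f, μ_{N/2})` and `N = 2, 4, 8, …`;
`μs n` is the measure `μ_N` for `N = 2ⁿ`. -/
def localSobolevNorm {X : Type*} [MeasurableSpace X] (μ : Measure X) (φ : ℕ → X → ℝ)
    (ev : ℕ → ℝ) (H : ℝ → ℝ) (μs : ℕ → SignedMeasure X) (s : ℝ) (p : ℝ≥0∞) (B : Set X)
    (f : X → ℝ) : ℝ≥0∞ :=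
  eLpNorm f p μ + ⨆ n : ℕ, ENNReal.ofReal (((2 : ℝ) ^ (n + 1)) ^ s) *
    eLpNorm (sigma φ ev H (2 ^ (n + 1)) f (μs (n + 1)) - sigma φ ev H (2 ^ n) f (μs n)) p
      (μ.restrict B)

/-- The ball of radius `r` in the local Sobolev space `W^s(L_p(X), B)`. -/
def localSobolevBall {X : Type*} [TopologicalSpace X] [MeasurableSpace X] (μ : Measure X)
    (φ : ℕ → X → ℝ) (ev : ℕ → ℝ) (H : ℝ → ℝ) (μs : ℕ → SignedMeasure X) (s : ℝ) (p : ℝ≥0∞)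
    (B : Set X) (r : ℝ) : Set (X → ℝ) :=
  {f | MemX μ φ ev p f ∧ localSobolevNorm μ φ ev H μs s p B f ≤ ENNReal.ofReal r}

/-- The quantization `I_N(f, ν, y) = ⌊N^S σ_N(f, ν, y)⌋`. -/
def quantized {X : Type*} [MeasurableSpace X] (φ : ℕ → X → ℝ) (ev : ℕ → ℝ) (H : ℝ → ℝ) (S N : ℝ)
    (f : X → ℝ) (ν : SignedMeasure X) (y : X) : ℤ :=
  ⌊N ^ S * sigma φ ev H N f ν y⌋

/-- The locally quantized operator
`σ°_N(f, ν₁, ν₂, B)(x) = N^{-S} ∑ₖ H(λₖ / (2N)) (∫_B I_N(f, ν₁, y) φₖ(y) dν₂(y)) φₖ(x)`. -/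
def sigmaQuant {X : Type*} [MeasurableSpace X] (φ : ℕ → X → ℝ) (ev : ℕ → ℝ) (H : ℝ → ℝ)
    (S N : ℝ) (f : X → ℝ) (ν₁ ν₂ : SignedMeasure X) (B : Set X) (x : X) : ℝ :=
  N ^ (-S) * ∑' k, H (ev k / (2 * N)) *
    (∫ᵛ y in B, (quantized φ ev H S N f ν₁ y : ℝ) * φ k y ∂<•ν₂) * φ k x

/-- `z` is one of the `2^w` integers of a signed (two's complement) binary word of length `w`,
i.e. `-2^(w-1) ≤ z < 2^(w-1)`; for `w = 0` only `z = 0`. -/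
def FitsInBits (w : ℕ) (z : ℤ) : Prop := -2 ^ w ≤ 2 * z ∧ 2 * z < 2 ^ w

/-- With at most `L` bits altogether one can represent all the integers `I y`, `y ∈ Y`, for every
`I ∈ F`: each integer is written as a binary word of a fixed length `w`, the same for all `I ∈ F`
and all `y ∈ Y`, and the `#Y` words together have at most `L` bits. -/
def RepresentableWithBits {X : Type*} (Y : Set X) (F : Set (X → ℤ)) (L : ℕ) : Prop :=
  Y.Finite ∧ ∃ w : ℕ, (∀ I ∈ F, ∀ y ∈ Y, FitsInBits w (I y)) ∧ Y.ncard * w ≤ L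

end

end DiffusionSpace

namespace DiffusionSpace

noncomputable section

/-- The Fourier coefficients of a smooth periodic function decay rapidly. -/
theorem fourierCoeffOn_rapid_decay {a b : ℝ} (hab : a < b) (Q : ℕ) :
    ∀ g : ℝ → ℂ, ContDiff ℝ (⊤ : ℕ∞) g → Function.Periodic g (b - a) →
      ∃ C : ℝ, ∀ n : ℤ, |(n : ℝ)| ^ Q * ‖fourierCoeffOn hab g n‖ ≤ C := by
  induction Q with
  | zero =>
    intro g hg _
    obtain ⟨M, hM⟩ := isCompact_Icc.exists_bound_of_continuousOn (s := Set.Icc a b)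
      hg.continuous.continuousOn
    refine ⟨‖(1 / (b - a) : ℝ)‖ * (M * |b - a|), fun n => ?_⟩
    rw [fourierCoeffOn_eq_integral, norm_smul, pow_zero, one_mul]
    gcongr
    refine intervalIntegral.norm_integral_le_of_norm_le_const fun x hx => ?_
    rw [Set.uIoc_of_le hab.le] at hx
    have : Fact (0 < b - a) := ⟨by linarith⟩
    rw [norm_smul, fourier_apply, Circle.norm_coe, one_mul]
    exact hM x (Set.Ioc_subset_Icc_self hx)
  | succ Q ih =>
    intro g hg hper
    have hg' : ContDiff ℝ (⊤ : ℕ∞) (deriv g) := (contDiff_infty_iff_deriv.1 hg).2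
    have hper' : Function.Periodic (deriv g) (b - a) := fun x => by
      rw [← deriv_comp_add_const]
      congr 1
      exact funext hper
    obtain ⟨C, hC⟩ := ih _ hg' hper'
    refine ⟨(b - a) / (2 * Real.pi) * max C 0, fun n => ?_⟩
    rcases eq_or_ne n 0 with rfl | hn
    · simp only [Int.cast_zero, abs_zero, ne_eq, Nat.add_eq_zero_iff, one_ne_zero, and_false,
        not_false_eq_true, zero_pow, zero_mul]
      have := Real.pi_pos
      have : 0 < b - a := by linarith
      positivity
    have hgab : g b - g a = 0 := by
      have := hper a
      simp only [add_sub_cancel] at this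
      rw [this, sub_self]
    have key := fourierCoeffOn_of_hasDerivAt hab hn (f := g) (f' := deriv g)
      (fun x _ => (hg.differentiable (by simp) x).hasDerivAt)
      (hg'.continuous.intervalIntegrable _ _)
    rw [hgab, mul_zero, zero_sub] at key
    rw [key]
    have hn' : 0 < |(n : ℝ)| := abs_pos.2 (by exact_mod_cast hn)
    have e1 : ‖(b : ℂ) - a‖ = b - a := by
      rw [← Complex.ofReal_sub, Complex.norm_real, Real.norm_of_nonneg (by linarith)]
    have e2 : ‖(1 : ℂ) / (-2 * Real.pi * Complex.I * n)‖ = 1 / (2 * Real.pi * |(n : ℝ)|) := by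
      simp [abs_of_pos Real.pi_pos]
    rw [norm_mul, norm_neg, norm_mul, e1, e2]
    calc |(n : ℝ)| ^ (Q + 1) * (1 / (2 * Real.pi * |(n : ℝ)|) *
          ((b - a) * ‖fourierCoeffOn hab (deriv g) n‖))
        = (b - a) / (2 * Real.pi) * (|(n : ℝ)| ^ Q * ‖fourierCoeffOn hab (deriv g) n‖) := by
          field_simp
          ring
      _ ≤ _ := by
          have := Real.pi_pos
          have : 0 < b - a := by linarith
          gcongr
          exact (hC n).trans (le_max_left _ _)

/-- Chebyshev expansion of a smooth function, with rapidly decreasing coefficients. -/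
theorem exists_chebyshev_expansion {F : ℝ → ℝ} (hF : ContDiff ℝ (⊤ : ℕ∞) F) :
    ∃ c : ℤ → ℝ, (∀ Q : ℕ, ∃ C : ℝ, ∀ n : ℤ, |(n : ℝ)| ^ Q * |c n| ≤ C) ∧
      ∀ θ : ℝ, HasSum (fun n : ℤ => c n * Real.cos (n * θ)) (F (Real.cos θ)) := by
  have hT : Fact (0 < 2 * Real.pi) := ⟨Real.two_pi_pos⟩
  set g : ℝ → ℂ := fun θ => (F (Real.cos θ) : ℂ) with hg
  have hgs : ContDiff ℝ (⊤ : ℕ∞) g :=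
    Complex.ofRealCLM.contDiff.comp (hF.comp Real.contDiff_cos)
  have hper : Function.Periodic g (2 * Real.pi) := fun x => by simp [hg]
  let G : C(AddCircle (2 * Real.pi), ℂ) :=
    ⟨hper.lift, by
      refine continuous_quot_lift _ ?_
      exact hgs.continuous⟩
  have hab : (0 : ℝ) < 2 * Real.pi := Real.two_pi_pos
  have hcoef : ∀ n, fourierCoeff G n = fourierCoeffOn hab g n := by
    intro n
    rw [fourierCoeffOn_eq_integral, fourierCoeff_eq_intervalIntegral _ _ 0]
    simp only [fourier_coe_apply, zero_add, sub_zero]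
    rfl
  have hdecay : ∀ Q : ℕ, ∃ C : ℝ, ∀ n : ℤ, |(n : ℝ)| ^ Q * ‖fourierCoeff G n‖ ≤ C := by
    intro Q
    obtain ⟨C, hC⟩ := fourierCoeffOn_rapid_decay hab Q g hgs (by simpa using hper)
    exact ⟨C, fun n => by rw [hcoef]; exact hC n⟩
  have hsum : Summable (fourierCoeff G) := by
    obtain ⟨C, hC⟩ := hdecay 2
    have h1 : Summable fun n : ℤ => C * (1 / (n : ℝ) ^ 2) :=
      (Real.summable_one_div_int_pow.2 one_lt_two).mul_left C
    refine Summable.of_norm_bounded_eventually h1 ?_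
    rw [Filter.eventually_cofinite]
    refine (Set.finite_singleton (0 : ℤ)).subset fun n hn => ?_
    by_contra hne
    apply hn
    have hn' : 0 < |(n : ℝ)| := abs_pos.2 (by exact_mod_cast hne)
    rw [mul_one_div, ← sq_abs, le_div_iff₀ (by positivity), mul_comm]
    exact hC n
  refine ⟨fun n => (fourierCoeff G n).re, fun Q => ?_, fun θ => ?_⟩
  · obtain ⟨C, hC⟩ := hdecay Q
    exact ⟨C, fun n => le_trans (by gcongr; exact Complex.abs_re_le_norm _) (hC n)⟩
  · have key : ∀ t : ℝ, HasSum (fun n : ℤ => (fourierCoeff G n * Complex.exp (n * t * Complex.I)))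
        (g t) := by
      intro t
      have := has_pointwise_sum_fourier_series_of_summable hsum (t : AddCircle (2 * Real.pi))
      have hGt : G (t : AddCircle (2 * Real.pi)) = g t := rfl
      rw [hGt] at this
      convert this using 1
      ext n
      rw [fourier_coe_apply, smul_eq_mul]
      congr 2
      have : (Real.pi : ℂ) ≠ 0 := by exact_mod_cast Real.pi_ne_zero
      push_cast
      field_simp
    have h2 := ((key θ).add (key (-θ))).mul_left (1 / 2 : ℂ)
    have h3 := Complex.hasSum_re h2
    convert h3 using 1
    · ext n
      have : (1 / 2 : ℂ) * (fourierCoeff G n * Complex.exp (n * θ * Complex.I) +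
          fourierCoeff G n * Complex.exp (n * ((-θ : ℝ) : ℂ) * Complex.I)) =
          fourierCoeff G n * ((Real.cos (n * θ) : ℝ) : ℂ) := by
        rw [Complex.ofReal_cos, Complex.cos]
        push_cast
        ring_nf
      rw [this, Complex.re_mul_ofReal]
    · simp only [hg, Real.cos_neg]
      rw [← Complex.ofReal_add]
      have : (1 / 2 : ℂ) = ((1 / 2 : ℝ) : ℂ) := by push_cast; rfl
      rw [this, Complex.re_ofReal_mul, Complex.ofReal_re]
      ring

/-- Truncated Chebyshev expansions of a smooth function converge faster than any power. -/
theorem exists_chebyshev_approx {F : ℝ → ℝ} (hF : ContDiff ℝ (⊤ : ℕ∞) F) :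
    ∃ c : ℤ → ℝ, Summable (fun n => |c n|) ∧ ∀ Q : ℕ, ∃ C : ℝ, 0 ≤ C ∧ ∀ (m : ℕ) (x : ℝ), |x| ≤ 1 →
      ((m : ℝ) + 1) ^ Q * |F x - ∑ n ∈ Finset.Icc (-m : ℤ) m,
        c n * (Polynomial.Chebyshev.T ℝ n).eval x| ≤ C := by
  obtain ⟨c, hc, hs⟩ := exists_chebyshev_expansion hF
  have hsum : ∀ Q : ℕ, Summable fun n : ℤ => |(n : ℝ)| ^ Q * |c n| := by
    intro Q
    obtain ⟨C, hC⟩ := hc (Q + 2)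
    have h1 : Summable fun n : ℤ => C * (1 / (n : ℝ) ^ 2) :=
      (Real.summable_one_div_int_pow.2 one_lt_two).mul_left C
    refine Summable.of_norm_bounded_eventually h1 ?_
    rw [Filter.eventually_cofinite]
    refine (Set.finite_singleton (0 : ℤ)).subset fun n hn => ?_
    by_contra hne
    apply hn
    have hn' : 0 < |(n : ℝ)| := abs_pos.2 (by exact_mod_cast hne)
    rw [mul_one_div, ← sq_abs, le_div_iff₀ (by positivity), Real.norm_of_nonneg (by positivity)]
    refine le_trans (le_of_eq ?_) (hC n)
    ring
  refine ⟨c, by simpa using hsum 0, fun Q => ⟨∑' n : ℤ, |(n : ℝ)| ^ Q * |c n|,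
    tsum_nonneg fun n => by positivity, fun m x hx => ?_⟩⟩
  obtain ⟨h1, h2⟩ := abs_le.1 hx
  obtain ⟨θ, rfl⟩ : ∃ θ, Real.cos θ = x := ⟨Real.arccos x, Real.cos_arccos h1 h2⟩
  simp only [Polynomial.Chebyshev.T_real_cos]
  have hsplit := (hs θ).summable.sum_add_tsum_compl (s := Finset.Icc (-m : ℤ) m)
  rw [← (hs θ).tsum_eq, ← hsplit, add_sub_cancel_left, ← abs_of_pos (a := ((m : ℝ) + 1) ^ Q)
    (by positivity), ← abs_mul, ← tsum_mul_left]
  have hle : ∀ n : ((Finset.Icc (-m : ℤ) m : Finset ℤ) : Set ℤ)ᶜ.Elem,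
      ‖((m : ℝ) + 1) ^ Q * (c n * Real.cos ((n : ℤ) * θ))‖ ≤ |((n : ℤ) : ℝ)| ^ Q * |c n| := by
    rintro ⟨n, hn⟩
    have hn' : (m : ℝ) + 1 ≤ |(n : ℝ)| := by
      have : (m : ℤ) + 1 ≤ |n| := by
        simp only [Set.mem_compl_iff, Finset.mem_coe, Finset.mem_Icc] at hn
        by_contra hlt
        exact hn (abs_le.1 (by omega))
      exact_mod_cast this
    rw [norm_mul, norm_mul, Real.norm_of_nonneg (by positivity)]
    gcongr
    rw [Real.norm_eq_abs]
    have := Real.abs_cos_le_one ((n : ℝ) * θ)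
    calc |c n| * ‖Real.cos (n * θ)‖ ≤ |c n| * 1 := by gcongr; exact this
      _ = _ := mul_one _
  have hsub := (hsum Q).subtype ((Finset.Icc (-m : ℤ) m : Finset ℤ) : Set ℤ)ᶜ
  refine (tsum_of_norm_bounded hsub.hasSum hle).trans ?_
  exact (hsum Q).tsum_subtype_le _ _ (fun n => by positivity)

/-- Sums weighted by shifted Chebyshev polynomials are controlled by the corresponding moments. -/
theorem abs_tsum_chebyshev_le {w u : ℕ → ℝ} (hw : Summable fun k => |w k|)
    (hu : ∀ k, 0 ≤ u k ∧ u k ≤ 1) {M : ℝ} (j : ℕ) :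
    ∀ i : ℕ, (∀ l ≤ i + j, |∑' k, w k * u k ^ l| ≤ M) →
      |∑' k, w k * u k ^ i * (Polynomial.Chebyshev.T ℝ j).eval (2 * u k - 1)| ≤ 7 ^ j * M := by
  have hsm : ∀ (i : ℕ) (j : ℤ),
      Summable fun k => w k * u k ^ i * (Polynomial.Chebyshev.T ℝ j).eval (2 * u k - 1) := by
    intro i j
    refine Summable.of_norm_bounded hw fun k => ?_
    rw [norm_mul, norm_mul, Real.norm_eq_abs, Real.norm_eq_abs, Real.norm_eq_abs, mul_assoc]
    refine mul_le_of_le_one_right (abs_nonneg _) ?_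
    have h1 : |u k ^ i| ≤ 1 := by
      rw [abs_pow]
      exact pow_le_one₀ (abs_nonneg _) (abs_le.2 ⟨by linarith [(hu k).1], (hu k).2⟩)
    have h2 := Polynomial.Chebyshev.abs_eval_T_real_le_one j (x := 2 * u k - 1)
      (abs_le.2 ⟨by linarith [(hu k).1], by linarith [(hu k).2]⟩)
    exact mul_le_one₀ h1 (abs_nonneg _) h2
  induction j using Nat.twoStepInduction with
  | zero =>
    intro i hi
    simpa using hi i le_rfl
  | one =>
    intro i hi
    have h0 := hi i (by omega)
    have h1 := hi (i + 1) (by omega)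
    have s0 := hsm i 0
    have s1 := hsm (i + 1) 0
    simp only [Polynomial.Chebyshev.T_zero, Polynomial.eval_one, mul_one] at s0 s1
    have e : ∑' k, w k * u k ^ i * (Polynomial.Chebyshev.T ℝ (1 : ℕ)).eval (2 * u k - 1) =
        2 * ∑' k, w k * u k ^ (i + 1) - ∑' k, w k * u k ^ i := by
      rw [← tsum_mul_left, ← (s1.mul_left 2).tsum_sub s0]
      refine tsum_congr fun k => ?_
      simp
      ring
    rw [e]
    rw [abs_le] at *
    constructor <;> linarith [h0.1, h0.2, h1.1, h1.2]
  | more j ih0 ih1 =>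
    intro i hi
    have h0 := ih0 i fun l hl => hi l (by omega)
    have h1 := ih1 i fun l hl => hi l (by omega)
    have h2 := ih1 (i + 1) fun l hl => hi l (by omega)
    have e : ∑' k, w k * u k ^ i * (Polynomial.Chebyshev.T ℝ (j + 2 : ℕ)).eval (2 * u k - 1) =
        4 * ∑' k, w k * u k ^ (i + 1) *
            (Polynomial.Chebyshev.T ℝ (j + 1 : ℕ)).eval (2 * u k - 1)
        - 2 * ∑' k, w k * u k ^ i * (Polynomial.Chebyshev.T ℝ (j + 1 : ℕ)).eval (2 * u k - 1)
        - ∑' k, w k * u k ^ i * (Polynomial.Chebyshev.T ℝ (j : ℕ)).eval (2 * u k - 1) := by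
      rw [← tsum_mul_left, ← tsum_mul_left, ← ((hsm (i + 1) (j + 1 : ℕ)).mul_left 4).tsum_sub
        ((hsm i (j + 1 : ℕ)).mul_left 2), ← Summable.tsum_sub
        (((hsm (i + 1) (j + 1 : ℕ)).mul_left 4).sub ((hsm i (j + 1 : ℕ)).mul_left 2)) (hsm i j)]
      refine tsum_congr fun k => ?_
      push_cast
      rw [Polynomial.Chebyshev.T_add_two]
      simp
      ring
    have hM : 0 ≤ M := (abs_nonneg _).trans (hi 0 (by omega))
    have p0 : 0 ≤ 7 ^ j * M := by positivity
    rw [e]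
    rw [pow_succ] at h1 h2
    rw [pow_succ, pow_succ]
    rw [abs_le] at *
    constructor <;> nlinarith [h0.1, h0.2, h1.1, h1.2, h2.1, h2.2]

end

end DiffusionSpace

namespace DiffusionSpace

noncomputable section

theorem IsQuasiMetric.t2Space {X : Type*} [TopologicalSpace X] {ρ : X → X → ℝ}
    (h : IsQuasiMetric ρ) : T2Space X := by
  obtain ⟨κ, hκ, htri⟩ := h.quasi_triangle
  rw [t2Space_iff_nhds]
  intro x y hxy
  have hd : 0 < ρ x y :=
    lt_of_le_of_ne (h.nonneg x y) fun h0 => hxy ((h.eq_zero_iff x y).1 h0.symm)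
  have hr : 0 < ρ x y / (2 * κ) := by positivity
  refine ⟨_, (h.nhds_basis x).mem_of_mem hr, _, (h.nhds_basis y).mem_of_mem hr, ?_⟩
  rw [Set.disjoint_left]
  intro z hz hz'
  simp only [Set.mem_ofPred_eq] at hz hz'
  have h1 := htri x z y
  rw [h.symm y z] at hz'
  have h2 : κ * (ρ x z + ρ z y) < κ * (ρ x y / (2 * κ) + ρ x y / (2 * κ)) := by gcongr
  have h3 : κ * (ρ x y / (2 * κ) + ρ x y / (2 * κ)) = ρ x y := by field_simp; ring
  linarith

theorem heatKernel_self_eq {X : Type*} (φ : ℕ → X → ℝ) (ev : ℕ → ℝ) (t : ℝ) (x : X) :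
    heatKernel φ ev t x x = ∑' k, Real.exp (-(ev k) ^ 2 * t) * φ k x ^ 2 :=
  tsum_congr fun k => by ring

section Diffusion

variable {X : Type*} [TopologicalSpace X] [MeasurableSpace X] [BorelSpace X]
  {ρ : X → X → ℝ} {μ : Measure X} [IsProbabilityMeasure μ] {φ : ℕ → X → ℝ} {ev : ℕ → ℝ} {α : ℝ}

theorem IsDiffusionMeasureSpace.measurableSet_qBall (hX : IsDiffusionMeasureSpace ρ μ φ ev α)
    (x : X) {t : ℝ} (ht : 0 < t) : MeasurableSet (qBall ρ x t) := by
  have := hX.isQuasiMetric.t2Space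
  exact (hX.compact_ball x t ht).isClosed.measurableSet

theorem IsDiffusionMeasureSpace.ev_nonneg (hX : IsDiffusionMeasureSpace ρ μ φ ev α) (k : ℕ) :
    0 ≤ ev k := by
  rw [← hX.ev_zero]; exact hX.ev_mono (Nat.zero_le k)

theorem IsDiffusionMeasureSpace.measurable_φ (hX : IsDiffusionMeasureSpace ρ μ φ ev α) (k : ℕ) :
    Measurable (φ k) := (hX.continuous k).measurable

theorem IsDiffusionMeasureSpace.memLp_φ (hX : IsDiffusionMeasureSpace ρ μ φ ev α) (k : ℕ) :
    MemLp (φ k) 2 μ := by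
  obtain ⟨b, hb⟩ := hX.hilbertBasis
  exact (memLp_congr_ae (hb k)).1 (Lp.memLp (b k))

theorem IsDiffusionMeasureSpace.integral_mul (hX : IsDiffusionMeasureSpace ρ μ φ ev α) (i j : ℕ) :
    ∫ x, φ i x * φ j x ∂μ = if i = j then 1 else 0 := by
  obtain ⟨b, hb⟩ := hX.hilbertBasis
  have h := (orthonormal_iff_ite.1 b.orthonormal) i j
  rw [L2.inner_def] at h
  rw [← h]
  refine integral_congr_ae ?_
  filter_upwards [hb i, hb j] with x hi hj
  rw [hi, hj]
  simp [mul_comm]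

theorem IsDiffusionMeasureSpace.summable_diag (hX : IsDiffusionMeasureSpace ρ μ φ ev α)
    {t : ℝ} (ht : 0 < t) (x : X) :
    Summable fun k => Real.exp (-(ev k) ^ 2 * t) * φ k x ^ 2 := by
  have small : ∀ s : ℝ, 0 < s → s < 1 →
      Summable fun k => Real.exp (-(ev k) ^ 2 * s) * φ k x ^ 2 := by
    intro s hs hs1
    obtain ⟨c, hc, h⟩ := hX.heat_lower
    have h1 := h x s hs hs1
    by_contra hns
    have : heatKernel φ ev s x x = 0 := by
      refine tsum_eq_zero_of_not_summable fun hsum => hns ?_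
      refine hsum.congr fun k => ?_
      ring
    rw [this] at h1
    have : 0 < c * s ^ (-α / 2) := mul_pos hc (Real.rpow_pos_of_pos hs _)
    linarith
  refine Summable.of_nonneg_of_le (fun k => by positivity) (fun k => ?_)
    (small (min t (1 / 2)) (by positivity) (by
      exact lt_of_le_of_lt (min_le_right _ _) (by norm_num)))
  gcongr ?_ * _
  apply Real.exp_le_exp.2
  rw [neg_mul, neg_mul, neg_le_neg_iff]
  gcongr
  exact min_le_left _ _

theorem IsDiffusionMeasureSpace.summable_offdiag (hX : IsDiffusionMeasureSpace ρ μ φ ev α)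
    {t : ℝ} (ht : 0 < t) (x y : X) :
    Summable fun k => |Real.exp (-(ev k) ^ 2 * t) * φ k x * φ k y| := by
  refine Summable.of_nonneg_of_le (fun k => by positivity) (fun k => ?_)
    ((hX.summable_diag ht x).add (hX.summable_diag ht y))
  rw [mul_assoc, abs_mul, abs_of_pos (Real.exp_pos _), abs_mul, ← mul_add]
  gcongr
  nlinarith [sq_nonneg (|φ k x| - |φ k y|), sq_abs (φ k x), sq_abs (φ k y), sq_nonneg (φ k x),
    sq_nonneg (φ k y)]

theorem IsDiffusionMeasureSpace.tsum_abs_le (hX : IsDiffusionMeasureSpace ρ μ φ ev α) :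
    ∃ C : ℝ, 0 < C ∧ ∀ t : ℝ, 0 < t → t ≤ 1 → ∀ x y,
      ∑' k, |Real.exp (-(ev k) ^ 2 * t) * φ k x * φ k y| ≤ C * t ^ (-α / 2) := by
  obtain ⟨c, C, hc, hC, h⟩ := hX.heat_upper
  refine ⟨2 * C, by positivity, fun t ht ht1 x y => ?_⟩
  have hd : ∀ z, ∑' k, Real.exp (-(ev k) ^ 2 * t) * φ k z ^ 2 ≤ C * t ^ (-α / 2) := by
    intro z
    rw [← heatKernel_self_eq]
    refine (le_abs_self _).trans ((h z z t ht ht1).trans ?_)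
    rw [(hX.isQuasiMetric.eq_zero_iff z z).2 rfl]
    simp
  calc ∑' k, |Real.exp (-(ev k) ^ 2 * t) * φ k x * φ k y|
      ≤ ∑' k, (Real.exp (-(ev k) ^ 2 * t) * φ k x ^ 2 + Real.exp (-(ev k) ^ 2 * t) * φ k y ^ 2) := by
        refine Summable.tsum_le_tsum (fun k => ?_) (hX.summable_offdiag ht x y)
          ((hX.summable_diag ht x).add (hX.summable_diag ht y))
        rw [mul_assoc, abs_mul, abs_of_pos (Real.exp_pos _), abs_mul, ← mul_add]
        gcongr
        nlinarith [sq_nonneg (|φ k x| - |φ k y|), sq_abs (φ k x), sq_abs (φ k y),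
          sq_nonneg (φ k x), sq_nonneg (φ k y)]
    _ ≤ C * t ^ (-α / 2) + C * t ^ (-α / 2) := by
        rw [(hX.summable_diag ht x).tsum_add (hX.summable_diag ht y)]
        exact add_le_add (hd x) (hd y)
    _ = _ := by ring

theorem IsDiffusionMeasureSpace.exists_bound (hX : IsDiffusionMeasureSpace ρ μ φ ev α) (k : ℕ) :
    ∃ M : ℝ, ∀ x, |φ k x| ≤ M := by
  obtain ⟨C, hC, h⟩ := hX.tsum_abs_le
  refine ⟨√(C / Real.exp (-(ev k) ^ 2 * 1)), fun x => ?_⟩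
  refine Real.abs_le_sqrt ?_
  rw [le_div_iff₀ (Real.exp_pos _)]
  have h1 := h 1 one_pos le_rfl x x
  have h2 := (hX.summable_offdiag one_pos x x).le_tsum k fun _ _ => abs_nonneg _
  have h3 : |Real.exp (-(ev k) ^ 2 * 1) * φ k x * φ k x| =
      φ k x ^ 2 * Real.exp (-(ev k) ^ 2 * 1) := by
    rw [mul_assoc, abs_of_nonneg (mul_nonneg (Real.exp_pos _).le (mul_self_nonneg _))]
    ring
  rw [h3] at h2
  simpa using h2.trans h1

theorem IsDiffusionMeasureSpace.integrable_φ (hX : IsDiffusionMeasureSpace ρ μ φ ev α) (k : ℕ) :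
    Integrable (φ k) μ := (hX.memLp_φ k).integrable one_le_two

theorem IsDiffusionMeasureSpace.integral_φ (hX : IsDiffusionMeasureSpace ρ μ φ ev α) (k : ℕ) :
    ∫ x, φ k x ∂μ = if k = 0 then 1 else 0 := by
  rw [← hX.integral_mul k 0]
  simp [hX.φ_zero]

theorem IsDiffusionMeasureSpace.integral_heatKernel (hX : IsDiffusionMeasureSpace ρ μ φ ev α)
    {t : ℝ} (ht : 0 < t) (ht1 : t ≤ 1) (x : X) : ∫ y, heatKernel φ ev t x y ∂μ = 1 := by
  obtain ⟨C, hC, h⟩ := hX.tsum_abs_le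
  have key := hasSum_integral_of_dominated_convergence (μ := μ)
    (F := fun k y => Real.exp (-(ev k) ^ 2 * t) * φ k x * φ k y)
    (f := fun y => heatKernel φ ev t x y)
    (fun k y => |Real.exp (-(ev k) ^ 2 * t) * φ k x * φ k y|)
    (fun k => ((hX.measurable_φ k).const_mul _).aestronglyMeasurable)
    (fun k => ae_of_all _ fun y => by rw [Real.norm_eq_abs])
    (ae_of_all _ fun y => hX.summable_offdiag ht x y)
    (by
      refine Integrable.of_bound (C := C * t ^ (-α / 2)) ?_ (ae_of_all _ fun y => ?_)
      · exact (Measurable.tsum fun k =>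
          ((hX.measurable_φ k).const_mul _).abs).aestronglyMeasurable
      · rw [Real.norm_of_nonneg (tsum_nonneg fun _ => abs_nonneg _)]
        exact h t ht ht1 x y)
    (ae_of_all _ fun y => (hX.summable_offdiag ht x y).of_abs.hasSum)
  have h2 : ∀ k, ∫ y, Real.exp (-(ev k) ^ 2 * t) * φ k x * φ k y ∂μ = if k = 0 then 1 else 0 := by
    intro k
    rw [integral_const_mul, hX.integral_φ]
    split_ifs with hk
    · subst hk; simp [hX.ev_zero, hX.φ_zero]
    · simp
  simp only [h2] at key
  exact key.unique (hasSum_ite_eq 0 1)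

theorem tendsto_heat_tail {c δ : ℝ} (hc : 0 < c) (hδ : 0 < δ) (C α : ℝ) :
    Tendsto (fun t : ℝ => C * t ^ (-α / 2) * Real.exp (-c * (δ ^ 2 / t))) (𝓝[>] 0) (𝓝 0) := by
  have h1 : Tendsto (fun s : ℝ => s ^ (α / 2) * Real.exp (-(c * δ ^ 2) * s)) atTop (𝓝 0) :=
    tendsto_rpow_mul_exp_neg_mul_atTop_nhds_zero _ _ (by positivity)
  have h2 := (h1.comp tendsto_inv_nhdsGT_zero).const_mul C
  rw [mul_zero] at h2
  refine h2.congr' ?_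
  filter_upwards [self_mem_nhdsWithin] with t ht
  have ht' : (0 : ℝ) < t := ht
  simp only [Function.comp]
  rw [Real.inv_rpow ht'.le, ← Real.rpow_neg ht'.le, mul_assoc]
  congr 3
  · ring
  · field_simp

theorem IsDiffusionMeasureSpace.exists_le_measure_qBall
    (hX : IsDiffusionMeasureSpace ρ μ φ ev α) {δ : ℝ} (hδ : 0 < δ) :
    ∃ c : ℝ, 0 < c ∧ ∀ x, c ≤ μ.real (qBall ρ x δ) := by
  obtain ⟨c, C, hc, hC, h⟩ := hX.heat_upper
  obtain ⟨C', hC', h'⟩ := hX.tsum_abs_le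
  have hev : ∀ᶠ t in 𝓝[>] (0 : ℝ),
      C * t ^ (-α / 2) * Real.exp (-c * (δ ^ 2 / t)) < 1 / 2 ∧ 0 < t ∧ t ≤ 1 := by
    refine ((tendsto_heat_tail hc hδ C α).eventually_lt_const (by norm_num)).and ?_
    exact Ioc_mem_nhdsGT one_pos
  obtain ⟨t, ht, ht0, ht1⟩ := hev.exists
  have hpos : 0 < C * t ^ (-α / 2) := mul_pos hC (Real.rpow_pos_of_pos ht0 _)
  refine ⟨1 / 2 / (C * t ^ (-α / 2)), by positivity, fun x => ?_⟩
  have hG : Integrable (fun y => heatKernel φ ev t x y) μ := by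
    by_contra hn
    have := hX.integral_heatKernel ht0 ht1 x
    rw [integral_undef hn] at this
    norm_num at this
  have hm := hX.measurableSet_qBall x hδ
  have hsplit := integral_add_compl hm hG
  rw [hX.integral_heatKernel ht0 ht1] at hsplit
  have h1 : ∫ y in qBall ρ x δ, heatKernel φ ev t x y ∂μ ≤
      C * t ^ (-α / 2) * μ.real (qBall ρ x δ) := by
    refine (Real.le_norm_self _).trans ?_
    refine norm_setIntegral_le_of_norm_le_const (measure_lt_top _ _) fun y _ => ?_
    refine (h x y t ht0 ht1).trans ?_
    refine mul_le_of_le_one_right hpos.le (Real.exp_le_one_iff.2 ?_)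
    have : 0 ≤ ρ x y ^ 2 / t := by positivity
    nlinarith
  have h2 : ∫ y in (qBall ρ x δ)ᶜ, heatKernel φ ev t x y ∂μ ≤ 1 / 2 := by
    refine (le_abs_self _).trans ?_
    have := norm_setIntegral_le_of_norm_le_const (μ := μ) (s := (qBall ρ x δ)ᶜ)
      (f := fun y => heatKernel φ ev t x y) (C := C * t ^ (-α / 2) * Real.exp (-c * (δ ^ 2 / t)))
      (measure_lt_top _ _) fun y hy => by
        refine (h x y t ht0 ht1).trans ?_
        gcongr ?_ * ?_
        apply Real.exp_le_exp.2
        have : δ < ρ x y := not_le.1 hy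
        rw [neg_mul, neg_mul, neg_le_neg_iff]
        gcongr
    refine this.trans ?_
    have hle : μ.real (qBall ρ x δ)ᶜ ≤ 1 := measureReal_le_one
    have hnn : 0 ≤ C * t ^ (-α / 2) * Real.exp (-c * (δ ^ 2 / t)) := by positivity
    nlinarith
  rw [div_le_iff₀ hpos]
  linarith

theorem IsDiffusionMeasureSpace.exists_diam (hX : IsDiffusionMeasureSpace ρ μ φ ev α) :
    ∃ D : ℝ, 1 ≤ D ∧ ∀ x y, ρ x y ≤ D := by
  obtain ⟨c, hc, hball⟩ := hX.exists_le_measure_qBall one_pos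
  obtain ⟨κ, hκ, htri⟩ := hX.isQuasiMetric.quasi_triangle
  have : Nonempty X := nonempty_of_isProbabilityMeasure μ
  obtain ⟨x₀⟩ := this
  have hmono : Monotone fun n : ℕ => qBall ρ x₀ n := fun a b hab y hy =>
    le_trans (show ρ x₀ y ≤ a from hy) (by exact_mod_cast hab)
  have hU : ⋃ n : ℕ, qBall ρ x₀ n = Set.univ := by
    ext y
    simp only [Set.mem_iUnion, Set.mem_univ, iff_true]
    obtain ⟨n, hn⟩ := exists_nat_ge (ρ x₀ y)
    exact ⟨n, hn⟩
  have hlim := tendsto_measure_iUnion_atTop (μ := μ) hmono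
  rw [hU, measure_univ] at hlim
  have hlim' : Tendsto (fun n : ℕ => μ.real (qBall ρ x₀ n)) atTop (𝓝 1) := by
    have := (ENNReal.tendsto_toReal ENNReal.one_ne_top).comp hlim
    rw [ENNReal.toReal_one] at this
    exact this
  obtain ⟨n, hn⟩ := (hlim'.eventually_const_lt (show 1 - c < 1 by linarith)).exists
  have hx : ∀ x, ρ x₀ x ≤ κ * (n + 1) := by
    intro x
    have hne : (qBall ρ x₀ n ∩ qBall ρ x 1).Nonempty := by
      by_contra hemp
      have hd : Disjoint (qBall ρ x₀ n) (qBall ρ x 1) :=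
        Set.disjoint_iff_inter_eq_empty.2 (Set.not_nonempty_iff_eq_empty.1 hemp)
      have h1 := measureReal_union (μ := μ) hd (hX.measurableSet_qBall x one_pos)
      have h2 : μ.real (qBall ρ x₀ n ∪ qBall ρ x 1) ≤ 1 := measureReal_le_one
      have := hball x
      linarith
    obtain ⟨z, hz, hz'⟩ := hne
    have hz1 : ρ x₀ z ≤ n := hz
    have hz2 : ρ x z ≤ 1 := hz'
    rw [hX.isQuasiMetric.symm] at hz2
    refine (htri x₀ z x).trans ?_
    gcongr
  refine ⟨max 1 (κ * (κ * (n + 1) + κ * (n + 1))), le_max_left _ _, fun x y => ?_⟩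
  refine le_trans ?_ (le_max_right _ _)
  refine (htri x x₀ y).trans ?_
  rw [hX.isQuasiMetric.symm x x₀]
  gcongr
  · exact hx x
  · exact hx y

theorem IsDiffusionMeasureSpace.compactSpace (hX : IsDiffusionMeasureSpace ρ μ φ ev α) :
    CompactSpace X := by
  obtain ⟨D, hD, h⟩ := hX.exists_diam
  have : Nonempty X := nonempty_of_isProbabilityMeasure μ
  obtain ⟨x₀⟩ := this
  refine ⟨?_⟩
  have : qBall ρ x₀ D = Set.univ := Set.eq_univ_of_forall fun y => h x₀ y
  rw [← this]
  exact hX.compact_ball x₀ D (by linarith)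

theorem IsDiffusionMeasureSpace.isOpenPosMeasure (hX : IsDiffusionMeasureSpace ρ μ φ ev α) :
    μ.IsOpenPosMeasure := by
  refine ⟨fun U hU ⟨x, hx⟩ h0 => ?_⟩
  obtain ⟨t, ht, hsub⟩ := (hX.isQuasiMetric.nhds_basis x).mem_iff.1 (hU.mem_nhds hx)
  obtain ⟨c, hc, hball⟩ := hX.exists_le_measure_qBall (half_pos ht)
  have h1 : qBall ρ x (t / 2) ⊆ U := fun y hy =>
    hsub (lt_of_le_of_lt (show ρ x y ≤ t / 2 from hy) (by linarith))
  have h2 : μ (qBall ρ x (t / 2)) = 0 := measure_mono_null h1 h0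
  have := hball x
  rw [measureReal_def, h2] at this
  simp at this
  linarith

/-- A continuous function is bounded by its essential supremum. -/
theorem IsDiffusionMeasureSpace.enorm_le_eLpNorm_top (hX : IsDiffusionMeasureSpace ρ μ φ ev α)
    {h : X → ℝ} (hc : Continuous h) (x : X) : ‖h x‖ₑ ≤ eLpNorm h ∞ μ := by
  have := hX.isOpenPosMeasure
  by_contra hlt
  rw [not_le] at hlt
  have hopen : IsOpen {y | eLpNorm h ∞ μ < ‖h y‖ₑ} := isOpen_lt continuous_const hc.enorm
  have h0 : μ {y | eLpNorm h ∞ μ < ‖h y‖ₑ} = 0 := by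
    have := ae_le_eLpNormEssSup (f := h) (μ := μ)
    rw [ae_iff] at this
    simpa only [not_le, eLpNorm_exponent_top] using this
  exact (hopen.measure_pos μ ⟨x, hlt⟩).ne' h0

end Diffusion

end

end DiffusionSpace

namespace DiffusionSpace

noncomputable section

/-- The kernel `∑ₖ H(λₖ / N) φₖ(x) φₖ(y)` of the summability operator. -/
def filterKernel {X : Type*} (φ : ℕ → X → ℝ) (ev : ℕ → ℝ) (H : ℝ → ℝ) (N : ℝ) (x y : X) : ℝ :=
  ∑' k, H (ev k / N) * φ k x * φ k y

/-- The function `F` with `exp (-λ²) F(exp (-λ²)) = H(λ)`. -/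
def expProfile (H : ℝ → ℝ) (u : ℝ) : ℝ :=
  if u ≤ Real.exp (-1) then 0 else H (√(-Real.log u)) / u

theorem expProfile_of_pos {H : ℝ → ℝ} (hH : IsLowPass H) {u : ℝ} (hu : 0 < u) :
    expProfile H u = H (√(-Real.log u)) / u := by
  unfold expProfile
  split_ifs with h
  · rw [hH.eq_zero, zero_div]
    rw [Real.one_le_sqrt]
    have := (Real.log_le_iff_le_exp hu).2 h
    linarith
  · rfl

theorem exp_mul_expProfile {H : ℝ → ℝ} (hH : IsLowPass H) {l : ℝ} (hl : 0 ≤ l) :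
    Real.exp (-l ^ 2) * expProfile H (Real.exp (-l ^ 2)) = H l := by
  rw [expProfile_of_pos hH (Real.exp_pos _), Real.log_exp, neg_neg, Real.sqrt_sq hl]
  field_simp

theorem contDiff_expProfile {H : ℝ → ℝ} (hH : IsLowPass H) :
    ContDiff ℝ (⊤ : ℕ∞) (expProfile H) := by
  rw [contDiff_iff_contDiffAt]
  intro u
  rcases lt_or_ge u (Real.exp (-1)) with h | h
  · refine (contDiffAt_const (c := (0 : ℝ))).congr_of_eventuallyEq ?_
    filter_upwards [Iio_mem_nhds h] with v hv
    exact if_pos (le_of_lt hv)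
  have hu : 0 < u := (Real.exp_pos _).trans_le h
  rcases lt_or_ge u 1 with h1 | h1
  · have hlog : 0 < -Real.log u := by linarith [Real.log_neg hu h1]
    have h2 : ContDiffAt ℝ (⊤ : ℕ∞) (fun v => H (√(-Real.log v)) / v) u := by
      refine ContDiffAt.div ?_ contDiffAt_id hu.ne'
      have hHat : ContDiffAt ℝ (⊤ : ℕ∞) H (√(-Real.log u)) :=
        hH.smooth.contDiffAt (Ici_mem_nhds (Real.sqrt_pos.2 hlog))
      exact hHat.comp u (ContDiffAt.sqrt (Real.contDiffAt_log.2 hu.ne').neg hlog.ne')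
    refine h2.congr_of_eventuallyEq ?_
    filter_upwards [Ioi_mem_nhds hu] with v hv
    exact expProfile_of_pos hH hv
  · have h2 : ContDiffAt ℝ (⊤ : ℕ∞) (fun v : ℝ => 1 / v) u :=
      contDiffAt_const.div contDiffAt_id hu.ne'
    refine h2.congr_of_eventuallyEq ?_
    have h3 : Real.exp (-(1 / 4)) < u := lt_of_lt_of_le (by rw [← Real.exp_zero]; exact Real.exp_lt_exp.2 (by norm_num)) h1
    filter_upwards [Ioi_mem_nhds h3] with v hv
    have hv' : Real.exp (-(1 / 4)) < v := hv
    have hv0 : 0 < v := (Real.exp_pos _).trans hv'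
    rw [expProfile_of_pos hH hv0, hH.eq_one _ (Real.sqrt_nonneg _)]
    rw [Real.sqrt_le_left (by norm_num)]
    have := (Real.lt_log_iff_exp_lt hv0).2 hv'
    norm_num
    linarith

theorem inv_sq_rpow {N : ℝ} (hN : 0 < N) (α : ℝ) : ((N ^ 2)⁻¹) ^ (-α / 2) = N ^ α := by
  rw [Real.inv_rpow (by positivity), ← Real.rpow_neg (by positivity), ← Real.rpow_natCast,
    ← Real.rpow_mul hN.le]
  congr 1
  push_cast
  ring

theorem abs_tsum_mul_le {w g : ℕ → ℝ} {B : ℝ} (hw : Summable fun k => |w k|)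
    (hg : ∀ k, |g k| ≤ B) : |∑' k, w k * g k| ≤ B * ∑' k, |w k| := by
  rw [← Real.norm_eq_abs]
  refine tsum_of_norm_bounded (hw.hasSum.mul_left B) fun k => ?_
  rw [norm_mul, Real.norm_eq_abs, Real.norm_eq_abs, mul_comm]
  gcongr
  exact hg k

section Diffusion

variable {X : Type*} [TopologicalSpace X] [MeasurableSpace X] [BorelSpace X]
  {ρ : X → X → ℝ} {μ : Measure X} [IsProbabilityMeasure μ] {φ : ℕ → X → ℝ} {ev : ℕ → ℝ} {α : ℝ}

/-- The kernels of smooth low-pass filters are concentrated near the diagonal. -/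
theorem IsDiffusionMeasureSpace.filterKernel_localized
    (hX : IsDiffusionMeasureSpace ρ μ φ ev α) {H : ℝ → ℝ} (hH : IsLowPass H) (Q : ℕ) :
    ∃ C : ℝ, 0 < C ∧ ∀ N : ℝ, 1 ≤ N → ∀ x y,
      (N * ρ x y) ^ Q * |filterKernel φ ev H N x y| ≤ C * N ^ α := by
  obtain ⟨D, hD1, hD⟩ := hX.exists_diam
  obtain ⟨c, C₁, hc, hC₁, hheat⟩ := hX.heat_upper
  obtain ⟨C₂, hC₂, habs⟩ := hX.tsum_abs_le
  have hF : ContDiff ℝ (⊤ : ℕ∞) fun x : ℝ => expProfile H ((1 + x) / 2) :=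
    (contDiff_expProfile hH).comp (by fun_prop)
  obtain ⟨a, hasum, happrox⟩ := exists_chebyshev_approx hF
  obtain ⟨C₃, hC₃, hA⟩ := happrox Q
  obtain ⟨C₄, hC₄, hA0⟩ := happrox 0
  set A := ∑' n, |a n| with hAdef
  have hA_nonneg : 0 ≤ A := tsum_nonneg fun _ => abs_nonneg _
  set η : ℝ := min (1 / D) (min 1 (c / 8)) with hη
  have hη0 : 0 < η := by
    refine lt_min (by positivity) (lt_min one_pos (by positivity))
  have hηD : η ≤ 1 / D := min_le_left _ _
  have hη1 : η ≤ 1 := (min_le_right _ _).trans (min_le_left _ _)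
  have hηc : η ≤ c / 8 := (min_le_right _ _).trans (min_le_right _ _)
  refine ⟨(1 / η) ^ Q * ((C₄ + |a 0|) * C₂) + (2 / η) ^ Q * (C₃ * C₂) + A * (C₁ * Q.factorial) + 1,
    by positivity, fun N hN x y => ?_⟩
  have hN0 : 0 < N := by linarith
  have hρ : 0 ≤ ρ x y := hX.isQuasiMetric.nonneg x y
  have hNα : 0 < N ^ α := Real.rpow_pos_of_pos hN0 _
  set t : ℝ := (N ^ 2)⁻¹ with ht
  have ht0 : 0 < t := by positivity
  have ht1 : t ≤ 1 := inv_le_one_of_one_le₀ (one_le_pow₀ hN)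
  set w : ℕ → ℝ := fun k => Real.exp (-(ev k) ^ 2 * t) * φ k x * φ k y with hw
  set u : ℕ → ℝ := fun k => Real.exp (-(ev k) ^ 2 * t) with hu
  have hu01 : ∀ k, 0 ≤ u k ∧ u k ≤ 1 := fun k =>
    ⟨(Real.exp_pos _).le, Real.exp_le_one_iff.2 (by
      have : 0 ≤ ev k ^ 2 * t := by positivity
      linarith)⟩
  have huabs : ∀ k, |2 * u k - 1| ≤ 1 := fun k =>
    abs_le.2 ⟨by linarith [(hu01 k).1], by linarith [(hu01 k).2]⟩
  have hws : Summable fun k => |w k| := hX.summable_offdiag ht0 x y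
  have hwC : ∑' k, |w k| ≤ C₂ * N ^ α := by
    have := habs t ht0 ht1 x y
    rwa [ht, inv_sq_rpow hN0] at this
  have hK : filterKernel φ ev H N x y = ∑' k, w k * expProfile H ((1 + (2 * u k - 1)) / 2) := by
    refine tsum_congr fun k => ?_
    have e1 : u k = Real.exp (-(ev k / N) ^ 2) := by
      simp only [hu, ht]
      congr 1
      field_simp
    have e2 := exp_mul_expProfile hH (div_nonneg (hX.ev_nonneg k) hN0.le)
    rw [← e1] at e2
    rw [← e2, show (1 + (2 * u k - 1)) / 2 = u k by ring]
    simp only [hw, hu]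
    ring
  have hKcrude : |filterKernel φ ev H N x y| ≤ (C₄ + |a 0|) * C₂ * N ^ α := by
    rw [hK, mul_assoc]
    have hb : ∀ k, |expProfile H ((1 + (2 * u k - 1)) / 2)| ≤ C₄ + |a 0| := by
      intro k
      have := hA0 0 _ (huabs k)
      simp only [pow_zero, one_mul, Nat.cast_zero, neg_zero, Finset.Icc_self, Finset.sum_singleton,
        Polynomial.Chebyshev.T_zero, Polynomial.eval_one, mul_one] at this
      have h2 := abs_add_le (expProfile H ((1 + (2 * u k - 1)) / 2) - a 0) (a 0)
      rw [sub_add_cancel] at h2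
      linarith
    refine (abs_tsum_mul_le hws hb).trans ?_
    gcongr
  have hrest : ∀ {p q r s : ℝ}, 0 ≤ p → 0 ≤ q → 0 ≤ r → s ≤ p → s ≤ p + q + r + 1 := by
    intros; linarith
  rcases lt_or_ge (η * (N * ρ x y)) 1 with hsmall | hlarge
  · have h1 : (N * ρ x y) ^ Q ≤ (1 / η) ^ Q := by
      gcongr
      rw [le_div_iff₀ hη0]
      linarith
    calc (N * ρ x y) ^ Q * |filterKernel φ ev H N x y|
        ≤ (1 / η) ^ Q * ((C₄ + |a 0|) * C₂ * N ^ α) := by gcongr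
      _ = ((1 / η) ^ Q * ((C₄ + |a 0|) * C₂)) * N ^ α := by ring
      _ ≤ _ := by
          gcongr
          exact hrest (by positivity) (by positivity) (by positivity) le_rfl
  obtain ⟨m, hm1, hm2⟩ : ∃ m : ℕ, (m : ℝ) + 1 ≤ η * (N * ρ x y) ∧
      η * (N * ρ x y) ≤ 2 * ((m : ℝ) + 1) := by
    have hf1 : 1 ≤ ⌊η * (N * ρ x y)⌋₊ := Nat.le_floor (by simpa using hlarge)
    have hf2 := Nat.floor_le (zero_le_one.trans hlarge)
    have hf3 := Nat.lt_floor_add_one (η * (N * ρ x y))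
    obtain ⟨m, hm⟩ := Nat.exists_eq_add_of_le hf1
    rw [hm] at hf2 hf3
    push_cast at hf2 hf3
    have : (0 : ℝ) ≤ m := Nat.cast_nonneg m
    exact ⟨m, by linarith, by linarith⟩
  have hmN : (m : ℝ) + 1 ≤ N ^ 2 := by
    refine hm1.trans ?_
    have : η * ρ x y ≤ 1 := by
      calc η * ρ x y ≤ 1 / D * D := by gcongr; exact hD x y
        _ = 1 := by field_simp
    nlinarith
  have hz : 0 ≤ N * ρ x y := by positivity
  have hmom : ∀ l ≤ 0 + m, |∑' k, w k * u k ^ l| ≤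
      C₁ * N ^ α * Real.exp (-c * ((N * ρ x y) ^ 2 / (m + 1))) := by
    intro l hl
    have hl' : (l : ℝ) + 1 ≤ m + 1 := by
      have : (l : ℝ) ≤ m := by exact_mod_cast (by omega : l ≤ m)
      linarith
    have e : ∑' k, w k * u k ^ l = heatKernel φ ev ((l + 1) * t) x y := by
      refine tsum_congr fun k => ?_
      simp only [hw, hu]
      rw [← Real.exp_nat_mul, show -(ev k) ^ 2 * ((l + 1) * t) = -(ev k) ^ 2 * t +
        l * (-(ev k) ^ 2 * t) by ring, Real.exp_add]
      ring
    have hlt1 : (l + 1) * t ≤ 1 := by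
      rw [ht, ← div_eq_mul_inv, div_le_one (by positivity)]
      linarith
    rw [e]
    refine (hheat x y _ (by positivity) hlt1).trans ?_
    have h1 : (((l : ℝ) + 1) * t) ^ (-α / 2) ≤ N ^ α := by
      rw [Real.mul_rpow (by positivity) ht0.le, ht, inv_sq_rpow hN0]
      refine mul_le_of_le_one_left hNα.le ?_
      exact Real.rpow_le_one_of_one_le_of_nonpos (by linarith [(Nat.cast_nonneg l : (0 : ℝ) ≤ l)])
        (by linarith [hX.α_pos])
    gcongr C₁ * ?_ * Real.exp ?_
    rw [neg_mul, neg_mul, neg_le_neg_iff]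
    refine mul_le_mul_of_nonneg_left ?_ hc.le
    rw [div_le_div_iff₀ (by positivity) (by positivity), ht, mul_pow]
    have e3 : N ^ 2 * ρ x y ^ 2 * ((l + 1) * (N ^ 2)⁻¹) = ρ x y ^ 2 * (l + 1) := by
      field_simp
    rw [e3]
    gcongr
  have hexp : Real.exp (-c * ((N * ρ x y) ^ 2 / (m + 1))) ≤ Real.exp (-(8 * (N * ρ x y))) := by
    apply Real.exp_le_exp.2
    rw [neg_mul, neg_le_neg_iff, ← mul_div_assoc, le_div_iff₀ (by positivity)]
    have h1 : (m : ℝ) + 1 ≤ c / 8 * (N * ρ x y) := hm1.trans (by gcongr)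
    nlinarith
  have h7 : (7 : ℝ) ^ m ≤ Real.exp (7 * (N * ρ x y)) := by
    have h1 : (7 : ℝ) ≤ Real.exp 7 := by linarith [Real.add_one_le_exp (7 : ℝ)]
    calc (7 : ℝ) ^ m ≤ Real.exp 7 ^ m := by gcongr
      _ = Real.exp (m * 7) := by rw [← Real.exp_nat_mul]
      _ ≤ _ := by
        apply Real.exp_le_exp.2
        have : η * (N * ρ x y) ≤ N * ρ x y := mul_le_of_le_one_left hz hη1
        linarith
  have hmain : |∑ n ∈ Finset.Icc (-m : ℤ) m,
      a n * ∑' k, w k * (Polynomial.Chebyshev.T ℝ n).eval (2 * u k - 1)| ≤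
      A * (C₁ * N ^ α * Real.exp (-(N * ρ x y))) := by
    calc |∑ n ∈ Finset.Icc (-m : ℤ) m,
          a n * ∑' k, w k * (Polynomial.Chebyshev.T ℝ n).eval (2 * u k - 1)|
        ≤ ∑ n ∈ Finset.Icc (-m : ℤ) m, |a n| * (C₁ * N ^ α * Real.exp (-(N * ρ x y))) := by
          refine (Finset.abs_sum_le_sum_abs _ _).trans (Finset.sum_le_sum fun n hn => ?_)
          rw [abs_mul]
          gcongr
          rw [Finset.mem_Icc] at hn
          have hnm : n.natAbs ≤ m := by omega
          have h1 := abs_tsum_chebyshev_le hws hu01 n.natAbs 0 fun l hl =>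
            hmom l (by omega)
          simp only [pow_zero, mul_one, Polynomial.Chebyshev.T_natAbs] at h1
          refine h1.trans ?_
          calc (7 : ℝ) ^ n.natAbs * (C₁ * N ^ α * Real.exp (-c * ((N * ρ x y) ^ 2 / (m + 1))))
              ≤ Real.exp (7 * (N * ρ x y)) * (C₁ * N ^ α * Real.exp (-(8 * (N * ρ x y)))) := by
                gcongr
                refine le_trans ?_ h7
                gcongr
                norm_num
            _ = C₁ * N ^ α * (Real.exp (7 * (N * ρ x y)) * Real.exp (-(8 * (N * ρ x y)))) := by
                ring
            _ = _ := by
                rw [← Real.exp_add]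
                ring_nf
      _ ≤ _ := by
          rw [← Finset.sum_mul]
          gcongr
          exact hasum.sum_le_tsum _ fun _ _ => abs_nonneg _
  have hsummT : ∀ n : ℤ, Summable fun k =>
      w k * (Polynomial.Chebyshev.T ℝ n).eval (2 * u k - 1) := by
    intro n
    refine Summable.of_norm_bounded hws fun k => ?_
    rw [norm_mul, Real.norm_eq_abs]
    exact mul_le_of_le_one_right (abs_nonneg _)
      (Polynomial.Chebyshev.abs_eval_T_real_le_one n (huabs k))
  have hRk : ∀ k, |expProfile H ((1 + (2 * u k - 1)) / 2) - ∑ n ∈ Finset.Icc (-m : ℤ) m,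
        a n * (Polynomial.Chebyshev.T ℝ n).eval (2 * u k - 1)| ≤ C₃ / ((m : ℝ) + 1) ^ Q := by
    intro k
    rw [le_div_iff₀ (by positivity), mul_comm]
    exact hA m _ (huabs k)
  have hsplit : filterKernel φ ev H N x y =
      ∑ n ∈ Finset.Icc (-m : ℤ) m,
        a n * ∑' k, w k * (Polynomial.Chebyshev.T ℝ n).eval (2 * u k - 1) +
      ∑' k, w k * (expProfile H ((1 + (2 * u k - 1)) / 2) - ∑ n ∈ Finset.Icc (-m : ℤ) m,
        a n * (Polynomial.Chebyshev.T ℝ n).eval (2 * u k - 1)) := by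
    have e1 : ∑ n ∈ Finset.Icc (-m : ℤ) m,
        a n * ∑' k, w k * (Polynomial.Chebyshev.T ℝ n).eval (2 * u k - 1) =
        ∑' k, ∑ n ∈ Finset.Icc (-m : ℤ) m,
          a n * (w k * (Polynomial.Chebyshev.T ℝ n).eval (2 * u k - 1)) := by
      rw [Summable.tsum_finsetSum fun n _ => (hsummT n).mul_left _]
      exact Finset.sum_congr rfl fun n _ => tsum_mul_left.symm
    have s1 : Summable fun k => ∑ n ∈ Finset.Icc (-m : ℤ) m,
          a n * (w k * (Polynomial.Chebyshev.T ℝ n).eval (2 * u k - 1)) :=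
      summable_sum fun n _ => (hsummT n).mul_left _
    have s2 : Summable fun k => w k * (expProfile H ((1 + (2 * u k - 1)) / 2) -
        ∑ n ∈ Finset.Icc (-m : ℤ) m,
          a n * (Polynomial.Chebyshev.T ℝ n).eval (2 * u k - 1)) := by
      refine Summable.of_norm_bounded (hws.mul_left (C₃ / ((m : ℝ) + 1) ^ Q)) fun k => ?_
      rw [norm_mul, Real.norm_eq_abs, Real.norm_eq_abs, mul_comm]
      gcongr
      exact hRk k
    rw [hK, e1, ← s1.tsum_add s2]
    refine tsum_congr fun k => ?_
    rw [mul_sub, Finset.mul_sum, ← Finset.sum_congr rfl fun n _ => mul_left_comm (w k) (a n) _]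
    ring
  have hrem := abs_tsum_mul_le hws hRk
  rw [hsplit]
  calc (N * ρ x y) ^ Q * |_ + _|
      ≤ (N * ρ x y) ^ Q * (A * (C₁ * N ^ α * Real.exp (-(N * ρ x y))) +
          C₃ / ((m : ℝ) + 1) ^ Q * (C₂ * N ^ α)) := by
        gcongr
        refine (abs_add_le _ _).trans (add_le_add hmain (hrem.trans ?_))
        gcongr
    _ = A * (C₁ * ((N * ρ x y) ^ Q * Real.exp (-(N * ρ x y)))) * N ^ α +
          ((N * ρ x y) ^ Q / ((m : ℝ) + 1) ^ Q) * (C₃ * C₂) * N ^ α := by ring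
    _ ≤ A * (C₁ * Q.factorial) * N ^ α + (2 / η) ^ Q * (C₃ * C₂) * N ^ α := by
        have h1 : (N * ρ x y) ^ Q * Real.exp (-(N * ρ x y)) ≤ Q.factorial := by
          have := Real.pow_div_factorial_le_exp _ hz Q
          rw [Real.exp_neg, ← div_eq_mul_inv, div_le_iff₀ (Real.exp_pos _)]
          rw [div_le_iff₀ (by positivity)] at this
          linarith
        have h2 : (N * ρ x y) ^ Q / ((m : ℝ) + 1) ^ Q ≤ (2 / η) ^ Q := by
          rw [← div_pow]
          gcongr ?_ ^ Q
          rw [div_le_div_iff₀ (by positivity) hη0]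
          linarith
        gcongr
    _ ≤ _ := by
        have : 0 ≤ (1 / η) ^ Q * ((C₄ + |a 0|) * C₂) := by positivity
        rw [← add_mul]
        exact mul_le_mul_of_nonneg_right (by linarith) hNα.le

end Diffusion

end

end DiffusionSpace

namespace DiffusionSpace

noncomputable section

theorem filterKernel_comm {X : Type*} (φ : ℕ → X → ℝ) (ev : ℕ → ℝ) (H : ℝ → ℝ) (N : ℝ) (x y : X) :
    filterKernel φ ev H N x y = filterKernel φ ev H N y x :=
  tsum_congr fun k => by ring

/-- `ν` has the volume growth of an `α`-dimensional measure on all balls of radius at least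
`K / N`. -/
def IsRegularMeasure {X : Type*} [MeasurableSpace X] (ρ : X → X → ℝ) (α K M N : ℝ)
    (ν : Measure X) : Prop :=
  ∀ x t, K / N ≤ t → ν (qBall ρ x t) ≤ ENNReal.ofReal (M * t ^ α)

theorem IsRegularMeasure.two_mul {X : Type*} [MeasurableSpace X] {ρ : X → X → ℝ} {α K M N : ℝ}
    {ν : Measure X} (h : IsRegularMeasure ρ α K M N ν) :
    IsRegularMeasure ρ α (2 * K) M (2 * N) ν := fun x t ht => h x t (by
  rwa [mul_div_mul_left _ _ two_ne_zero] at ht)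

section Diffusion

variable {X : Type*} [TopologicalSpace X] [MeasurableSpace X] [BorelSpace X]
  {ρ : X → X → ℝ} {μ : Measure X} [IsProbabilityMeasure μ] {φ : ℕ → X → ℝ} {ev : ℕ → ℝ} {α : ℝ}

theorem IsDiffusionMeasureSpace.exists_cutoff (hX : IsDiffusionMeasureSpace ρ μ φ ev α)
    {H : ℝ → ℝ} (hH : IsLowPass H) {N : ℝ} (hN : 0 < N) :
    ∃ m : ℕ, ∀ k ∉ Finset.range m, H (ev k / N) = 0 := by
  obtain ⟨m, hm⟩ := (hX.ev_tendsto.eventually_ge_atTop N).exists_forall_of_atTop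
  refine ⟨m, fun k hk => hH.eq_zero _ ?_⟩
  rw [le_div_iff₀ hN, one_mul]
  exact hm k (by simpa using hk)

theorem IsDiffusionMeasureSpace.exists_filterKernel_eq_sum
    (hX : IsDiffusionMeasureSpace ρ μ φ ev α)
    {H : ℝ → ℝ} (hH : IsLowPass H) {N : ℝ} (hN : 0 < N) :
    ∃ m : ℕ, (∀ k ∉ Finset.range m, H (ev k / N) = 0) ∧ ∀ x y, filterKernel φ ev H N x y =
      ∑ k ∈ Finset.range m, H (ev k / N) * φ k x * φ k y := by
  obtain ⟨m, hm⟩ := hX.exists_cutoff hH hN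
  exact ⟨m, hm, fun x y => tsum_eq_sum fun k hk => by rw [hm k hk]; ring⟩

theorem IsDiffusionMeasureSpace.measurable_filterKernel_uncurry
    (hX : IsDiffusionMeasureSpace ρ μ φ ev α)
    {H : ℝ → ℝ} (hH : IsLowPass H) {N : ℝ} (hN : 0 < N) :
    Measurable fun p : X × X => filterKernel φ ev H N p.1 p.2 := by
  obtain ⟨m, -, h⟩ := hX.exists_filterKernel_eq_sum hH hN
  simp only [h]
  refine Finset.measurable_sum _ fun k _ => ?_
  exact (((hX.measurable_φ k).comp measurable_fst).const_mul _).mul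
    ((hX.measurable_φ k).comp measurable_snd)

theorem IsDiffusionMeasureSpace.measurable_filterKernel
    (hX : IsDiffusionMeasureSpace ρ μ φ ev α)
    {H : ℝ → ℝ} (hH : IsLowPass H) {N : ℝ} (hN : 0 < N) (x : X) :
    Measurable (filterKernel φ ev H N x) := by
  obtain ⟨m, -, h⟩ := hX.exists_filterKernel_eq_sum hH hN
  have : filterKernel φ ev H N x =
      fun y => ∑ k ∈ Finset.range m, H (ev k / N) * φ k x * φ k y := funext fun y => h x y
  rw [this]
  exact Finset.measurable_sum _ fun k _ => (hX.measurable_φ k).const_mul _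

theorem IsDiffusionMeasureSpace.filterKernel_mem_diffPoly
    (hX : IsDiffusionMeasureSpace ρ μ φ ev α)
    {H : ℝ → ℝ} (hH : IsLowPass H) {N : ℝ} (hN : 0 < N) (x : X) :
    filterKernel φ ev H N x ∈ diffPoly φ ev N := by
  obtain ⟨m, -, h⟩ := hX.exists_filterKernel_eq_sum hH hN
  have : filterKernel φ ev H N x =
      ∑ k ∈ Finset.range m, (H (ev k / N) * φ k x) • φ k := by
    ext y
    rw [h]
    simp
  rw [this]
  refine Submodule.sum_mem _ fun k _ => ?_
  rcases le_or_gt (ev k) N with hk | hk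
  · exact Submodule.smul_mem _ _ (Submodule.subset_span ⟨k, hk, rfl⟩)
  · rw [hH.eq_zero, zero_mul, zero_smul]
    · exact Submodule.zero_mem _
    · rw [le_div_iff₀ hN, one_mul]; exact hk.le

theorem IsDiffusionMeasureSpace.integral_filterKernel
    (hX : IsDiffusionMeasureSpace ρ μ φ ev α)
    {H : ℝ → ℝ} (hH : IsLowPass H) {N : ℝ} (hN : 0 < N) (x : X) :
    ∫ y, filterKernel φ ev H N x y ∂μ = 1 := by
  obtain ⟨m, hm, h⟩ := hX.exists_filterKernel_eq_sum hH hN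
  simp only [h]
  rw [integral_finsetSum _ fun k _ => (hX.integrable_φ k).const_mul _]
  simp only [integral_const_mul, hX.integral_φ, mul_ite, mul_one, mul_zero]
  have h0 : H (ev 0 / N) = 1 := by
    rw [hX.ev_zero, zero_div]; exact hH.eq_one 0 le_rfl (by norm_num)
  rw [Finset.sum_ite_eq', if_pos, h0, hX.φ_zero, mul_one]
  by_contra hmem
  rw [hm 0 hmem] at h0
  exact zero_ne_one h0

theorem IsDiffusionMeasureSpace.lintegral_envelope_le
    (hX : IsDiffusionMeasureSpace ρ μ φ ev α) {ν : Measure X} {K M A N : ℝ} (hN : 1 ≤ N)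
    (hK : 1 ≤ K) (hM : 0 ≤ M) (hA : 0 ≤ A) (hν : IsRegularMeasure ρ α K M N ν)
    {Q : ℕ} (hQ : α + 1 ≤ Q) {g : X → ℝ} {x : X} (h1 : ∀ y, g y ≤ A * N ^ α)
    (h2 : ∀ y, (N * ρ x y) ^ Q * g y ≤ A * N ^ α) :
    ∫⁻ y, ENNReal.ofReal (g y) ∂ν ≤ ENNReal.ofReal (2 ^ Q * A * M * K ^ α * 2) := by
  have hN0 : 0 < N := by linarith
  have hK0 : 0 < K := by linarith
  have hr : ∀ j : ℕ, 0 < K * 2 ^ j / N := fun j => by positivity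
  set b : ℕ → ℝ := fun j => 2 ^ Q * (A * N ^ α) * ((1 / 2) ^ j) ^ Q with hb
  have hb0 : ∀ j, 0 ≤ b j := fun j => by positivity
  have hpt : ∀ y, ENNReal.ofReal (g y) ≤ ∑' j : ℕ, ENNReal.ofReal (b j) *
      (qBall ρ x (K * 2 ^ j / N)).indicator 1 y := by
    intro y
    have hex : ∃ j : ℕ, N * ρ x y ≤ K * 2 ^ j := by
      obtain ⟨j, hj⟩ := pow_unbounded_of_one_lt (N * ρ x y) (one_lt_two : (1 : ℝ) < 2)
      exact ⟨j, hj.le.trans (le_mul_of_one_le_left (by positivity) hK)⟩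
    classical
    obtain ⟨j, hj, hmin⟩ : ∃ j : ℕ, N * ρ x y ≤ K * 2 ^ j ∧
        ∀ i < j, ¬ N * ρ x y ≤ K * 2 ^ i :=
      ⟨Nat.find hex, Nat.find_spec hex, fun i hi => Nat.find_min hex hi⟩
    refine le_trans ?_ (ENNReal.le_tsum j)
    have hmem : y ∈ qBall ρ x (K * 2 ^ j / N) := by
      change ρ x y ≤ _
      rw [le_div_iff₀ hN0]; linarith
    rw [Set.indicator_of_mem hmem, Pi.one_apply, mul_one]
    apply ENNReal.ofReal_le_ofReal
    rcases j with _ | i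
    · refine (h1 y).trans ?_
      simp only [hb, pow_zero, one_pow, mul_one]
      exact le_mul_of_one_le_left (by positivity) (one_le_pow₀ one_le_two)
    · have hi : (2 : ℝ) ^ i ≤ N * ρ x y := by
        have := not_le.1 (hmin i (Nat.lt_succ_self i))
        exact (le_mul_of_one_le_left (by positivity) hK).trans this.le
      by_cases hg : 0 ≤ g y
      · have h3 : (2 ^ i) ^ Q * g y ≤ A * N ^ α := le_trans (by gcongr) (h2 y)
        have h4 : g y = 2 ^ Q * ((2 ^ i) ^ Q * g y) * ((1 / 2) ^ (i + 1)) ^ Q := by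
          have : (2 : ℝ) ^ Q * (2 ^ i) ^ Q * ((1 / 2) ^ (i + 1)) ^ Q = 1 := by
            rw [← mul_pow, ← mul_pow, ← pow_succ', ← mul_pow]
            norm_num
          calc g y = (2 ^ Q * (2 ^ i) ^ Q * ((1 / 2) ^ (i + 1)) ^ Q) * g y := by rw [this, one_mul]
            _ = _ := by ring
        rw [h4]
        simp only [hb]
        gcongr
      · exact (not_le.1 hg).le.trans (hb0 _)
  calc ∫⁻ y, ENNReal.ofReal (g y) ∂ν
      ≤ ∫⁻ y, ∑' j : ℕ, ENNReal.ofReal (b j) *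
          (qBall ρ x (K * 2 ^ j / N)).indicator 1 y ∂ν := lintegral_mono hpt
    _ = ∑' j : ℕ, ENNReal.ofReal (b j) * ν (qBall ρ x (K * 2 ^ j / N)) := by
        rw [lintegral_tsum]
        · refine tsum_congr fun j => ?_
          rw [lintegral_const_mul, lintegral_indicator_one (hX.measurableSet_qBall x (hr j))]
          exact measurable_one.indicator (hX.measurableSet_qBall x (hr j))
        · intro j
          exact ((measurable_one.indicator
            (hX.measurableSet_qBall x (hr j))).const_mul _).aemeasurable
    _ ≤ ∑' j : ℕ, ENNReal.ofReal (2 ^ Q * A * M * K ^ α * (1 / 2) ^ j) := by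
        refine ENNReal.tsum_le_tsum fun j => ?_
        have h5 : ν (qBall ρ x (K * 2 ^ j / N)) ≤
            ENNReal.ofReal (M * (K * 2 ^ j / N) ^ α) := by
          refine hν x _ ?_
          gcongr
          exact le_mul_of_one_le_right hK0.le (one_le_pow₀ one_le_two)
        refine (mul_le_mul_right h5 _).trans ?_
        rw [← ENNReal.ofReal_mul (hb0 j)]
        apply ENNReal.ofReal_le_ofReal
        have hNα : 0 < N ^ α := Real.rpow_pos_of_pos hN0 _
        rw [Real.div_rpow (by positivity) hN0.le, Real.mul_rpow hK0.le (by positivity)]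
        have h6 : ((2 : ℝ) ^ j) ^ α * ((1 / 2) ^ j) ^ Q ≤ (1 / 2) ^ j := by
          have h2j : (1 : ℝ) ≤ 2 ^ j := one_le_pow₀ one_le_two
          have : ((2 : ℝ) ^ j) ^ α ≤ (2 ^ j) ^ ((Q : ℝ) - 1) :=
            Real.rpow_le_rpow_of_exponent_le h2j (by linarith)
          rw [Real.rpow_sub (by positivity), Real.rpow_natCast, Real.rpow_one] at this
          calc ((2 : ℝ) ^ j) ^ α * ((1 / 2) ^ j) ^ Q ≤ (2 ^ j) ^ Q / 2 ^ j * ((1 / 2) ^ j) ^ Q := by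
                gcongr
            _ = (2 ^ j * (1 / 2) ^ j) ^ Q / 2 ^ j := by rw [mul_pow]; ring
            _ = (1 / 2) ^ j := by
                rw [← mul_pow, one_div_pow]; norm_num
        calc b j * (M * (K ^ α * (2 ^ j) ^ α / N ^ α))
            = 2 ^ Q * A * M * K ^ α * ((2 ^ j) ^ α * ((1 / 2) ^ j) ^ Q) := by
              simp only [hb]; field_simp
          _ ≤ _ := by gcongr
    _ = _ := by
        rw [← ENNReal.ofReal_tsum_of_nonneg (fun j => by positivity)
          (summable_geometric_two.mul_left _), tsum_mul_left, tsum_geometric_two]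

/-- Uniform `L₁` bound for the kernels, with respect to any measure with the right growth. -/
theorem IsDiffusionMeasureSpace.exists_lintegral_filterKernel_le
    (hX : IsDiffusionMeasureSpace ρ μ φ ev α) {H : ℝ → ℝ} (hH : IsLowPass H) {K M : ℝ}
    (hK : 1 ≤ K) (hM : 0 ≤ M) :
    ∃ C : ℝ, 0 < C ∧ ∀ N : ℝ, 1 ≤ N → ∀ ν : Measure X, IsRegularMeasure ρ α K M N ν →
      ∀ x, ∫⁻ y, ‖filterKernel φ ev H N x y‖ₑ ∂ν ≤ ENNReal.ofReal C := by
  set Q := ⌈α + 1⌉₊ with hQ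
  obtain ⟨C₀, hC₀, h0⟩ := hX.filterKernel_localized hH 0
  obtain ⟨C₁, hC₁, h1⟩ := hX.filterKernel_localized hH Q
  refine ⟨2 ^ Q * (C₀ + C₁) * M * K ^ α * 2 + 1, by positivity, fun N hN ν hν x => ?_⟩
  have hNα : 0 < N ^ α := Real.rpow_pos_of_pos (by linarith) _
  have := hX.lintegral_envelope_le hN hK hM (by positivity : 0 ≤ C₀ + C₁) hν (Nat.le_ceil _)
    (g := fun y => |filterKernel φ ev H N x y|) (x := x)
    (fun y => by
      have := h0 N hN x y
      rw [pow_zero, one_mul] at this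
      refine this.trans ?_
      gcongr
      linarith)
    (fun y => (h1 N hN x y).trans (by gcongr; linarith))
  simp only [Real.enorm_eq_ofReal_abs]
  exact this.trans (ENNReal.ofReal_le_ofReal (by linarith))

theorem IsDiffusionMeasureSpace.exists_isRegularMeasure_self
    (hX : IsDiffusionMeasureSpace ρ μ φ ev α) :
    ∃ M : ℝ, 0 < M ∧ (∀ x t, 0 < t → μ (qBall ρ x t) ≤ ENNReal.ofReal (M * t ^ α)) ∧
      ∀ N : ℝ, 1 ≤ N → IsRegularMeasure ρ α 1 M N μ := by
  obtain ⟨M, hM, h⟩ := hX.volume_le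
  have h' : ∀ x t, 0 < t → μ (qBall ρ x t) ≤ ENNReal.ofReal (M * t ^ α) := by
    intro x t ht
    rw [← ofReal_measureReal]
    exact ENNReal.ofReal_le_ofReal (h x t ht)
  exact ⟨M, hM, h', fun N hN x t ht => h' x t (lt_of_lt_of_le (by positivity) ht)⟩

theorem IsDiffusionMeasureSpace.exists_lintegral_tail_le
    (hX : IsDiffusionMeasureSpace ρ μ φ ev α) {H : ℝ → ℝ} (hH : IsLowPass H) :
    ∃ K : ℝ, 1 ≤ K ∧ ∀ N : ℝ, 1 ≤ N → ∀ x,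
      ∫⁻ y in (qBall ρ x (K / N))ᶜ, ‖filterKernel φ ev H N x y‖ₑ ∂μ ≤ ENNReal.ofReal (1 / 2) := by
  obtain ⟨M, hM, -, hreg⟩ := hX.exists_isRegularMeasure_self
  set Q := ⌈α + 1⌉₊ with hQ
  obtain ⟨C₀, hC₀, h0⟩ := hX.filterKernel_localized hH 1
  obtain ⟨C₁, hC₁, h1⟩ := hX.filterKernel_localized hH (Q + 1)
  set C := 2 ^ Q * (C₀ + C₁) * M * (1 : ℝ) ^ α * 2 with hC
  have hCpos : 0 < C := by positivity
  refine ⟨max 1 (2 * C), le_max_left _ _, fun N hN x => ?_⟩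
  set K := max 1 (2 * C) with hK
  have hK0 : 0 < K := lt_of_lt_of_le one_pos (le_max_left _ _)
  have hN0 : 0 < N := by linarith
  have hNα : 0 < N ^ α := Real.rpow_pos_of_pos hN0 _
  have hm := hX.measurableSet_qBall x (div_pos hK0 hN0)
  have key := hX.lintegral_envelope_le hN le_rfl hM.le (by positivity : 0 ≤ C₀ + C₁) (hreg N hN)
    (Nat.le_ceil _)
    (g := fun y => (N * ρ x y) * |filterKernel φ ev H N x y|) (x := x)
    (fun y => by
      have := h0 N hN x y
      rw [pow_one] at this
      refine this.trans ?_
      gcongr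
      linarith)
    (fun y => by
      rw [← mul_assoc, ← pow_succ]
      exact (h1 N hN x y).trans (by gcongr; linarith))
  have h2 : ENNReal.ofReal K * ∫⁻ y in (qBall ρ x (K / N))ᶜ, ‖filterKernel φ ev H N x y‖ₑ ∂μ ≤
      ENNReal.ofReal C := by
    refine le_trans ?_ key
    rw [← lintegral_const_mul _ (hX.measurable_filterKernel hH hN0 x).enorm]
    refine le_trans (setLIntegral_mono' hm.compl fun y hy => ?_) (setLIntegral_le_lintegral _ _)
    rw [Real.enorm_eq_ofReal_abs, ← ENNReal.ofReal_mul hK0.le]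
    apply ENNReal.ofReal_le_ofReal
    gcongr
    have : K / N < ρ x y := not_le.1 hy
    rw [div_lt_iff₀ hN0] at this
    linarith
  have h3 : ENNReal.ofReal C ≤ ENNReal.ofReal K * ENNReal.ofReal (1 / 2) := by
    rw [← ENNReal.ofReal_mul hK0.le]
    apply ENNReal.ofReal_le_ofReal
    have : 2 * C ≤ K := le_max_right _ _
    linarith
  exact (ENNReal.mul_le_mul_iff_right (by simpa using hK0) ENNReal.ofReal_ne_top).1 (h2.trans h3)

/-- Lower bound for the mass of the kernels near the diagonal. -/
theorem IsDiffusionMeasureSpace.exists_le_setLIntegral_rpow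
    (hX : IsDiffusionMeasureSpace ρ μ φ ev α) {H : ℝ → ℝ} (hH : IsLowPass H) {q : ℝ} (hq : 1 ≤ q) :
    ∃ K c : ℝ, 1 ≤ K ∧ 0 < c ∧ ∀ N : ℝ, 1 ≤ N → ∀ y,
      ENNReal.ofReal (c * (N ^ α) ^ (q - 1)) ≤
        ∫⁻ z in qBall ρ y (K / N), ‖filterKernel φ ev H N z y‖ₑ ^ q ∂μ := by
  obtain ⟨K, hK, htail⟩ := hX.exists_lintegral_tail_le hH
  obtain ⟨M, hM, hvol, -⟩ := hX.exists_isRegularMeasure_self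
  have hK0 : 0 < K := by linarith
  have hKα : 0 < K ^ α := Real.rpow_pos_of_pos hK0 _
  refine ⟨K, 1 / 4 * (1 / (4 * M * K ^ α)) ^ (q - 1), hK, by positivity, fun N hN y => ?_⟩
  have hN0 : 0 < N := by linarith
  have hNα : 0 < N ^ α := Real.rpow_pos_of_pos hN0 _
  have hm := hX.measurableSet_qBall y (div_pos hK0 hN0)
  have hmeas := (hX.measurable_filterKernel hH hN0 y).enorm
  set l : ℝ := N ^ α / (4 * M * K ^ α) with hl
  have hl0 : 0 < l := by positivity
  have hone : ENNReal.ofReal 1 ≤ ∫⁻ z, ‖filterKernel φ ev H N y z‖ₑ ∂μ := by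
    have := enorm_integral_le_lintegral_enorm (μ := μ) (fun z => filterKernel φ ev H N y z)
    rw [hX.integral_filterKernel hH hN0] at this
    simpa using this
  have hhalf : ENNReal.ofReal (1 / 2) ≤
      ∫⁻ z in qBall ρ y (K / N), ‖filterKernel φ ev H N y z‖ₑ ∂μ := by
    rw [← lintegral_add_compl _ hm, show (1 : ℝ) = 1 / 2 + 1 / 2 by norm_num,
      ENNReal.ofReal_add (by norm_num) (by norm_num)] at hone
    exact (ENNReal.add_le_add_iff_right ENNReal.ofReal_ne_top).1
      (hone.trans (add_le_add le_rfl (htail N hN y)))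
  have hpt : ∀ z, ‖filterKernel φ ev H N y z‖ₑ ≤
      ENNReal.ofReal l + ENNReal.ofReal (l ^ (1 - q)) * ‖filterKernel φ ev H N z y‖ₑ ^ q := by
    intro z
    rw [filterKernel_comm φ ev H N z y, Real.enorm_eq_ofReal_abs]
    set v := |filterKernel φ ev H N y z| with hv
    have hv0 : 0 ≤ v := abs_nonneg _
    rw [ENNReal.ofReal_rpow_of_nonneg hv0 (by linarith), ← ENNReal.ofReal_mul (by positivity),
      ← ENNReal.ofReal_add hl0.le (by positivity)]
    apply ENNReal.ofReal_le_ofReal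
    rcases le_or_gt v l with h | h
    · have : 0 ≤ l ^ (1 - q) * v ^ q := by positivity
      linarith
    · have hvpos : 0 < v := hl0.trans h
      have h1 : v = v ^ (1 - q) * v ^ q := by
        rw [← Real.rpow_add hvpos]; simp
      have h2 : v ^ (1 - q) ≤ l ^ (1 - q) :=
        Real.rpow_le_rpow_of_nonpos hl0 h.le (by linarith)
      have h3 : v ^ (1 - q) * v ^ q ≤ l ^ (1 - q) * v ^ q := by gcongr
      linarith
  have h4 : ENNReal.ofReal (1 / 2) ≤ ENNReal.ofReal (1 / 4) + ENNReal.ofReal (l ^ (1 - q)) *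
      ∫⁻ z in qBall ρ y (K / N), ‖filterKernel φ ev H N z y‖ₑ ^ q ∂μ := by
    refine hhalf.trans ((lintegral_mono hpt).trans ?_)
    rw [lintegral_add_left measurable_const, lintegral_const_mul', setLIntegral_const]
    · gcongr
      refine (mul_le_mul_right (hvol y _ (div_pos hK0 hN0)) _).trans ?_
      rw [← ENNReal.ofReal_mul hl0.le]
      apply ENNReal.ofReal_le_ofReal
      rw [Real.div_rpow hK0.le hN0.le, hl]
      apply le_of_eq
      field_simp
    · exact ENNReal.ofReal_ne_top
  have h5 : ENNReal.ofReal (1 / 4) ≤ ENNReal.ofReal (l ^ (1 - q)) *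
      ∫⁻ z in qBall ρ y (K / N), ‖filterKernel φ ev H N z y‖ₑ ^ q ∂μ := by
    rw [show (1 / 2 : ℝ) = 1 / 4 + 1 / 4 by norm_num,
      ENNReal.ofReal_add (by norm_num) (by norm_num)] at h4
    exact (ENNReal.add_le_add_iff_left ENNReal.ofReal_ne_top).1 h4
  have h6 : 0 < l ^ (1 - q) := Real.rpow_pos_of_pos hl0 _
  refine (ENNReal.mul_le_mul_iff_right (a := ENNReal.ofReal (l ^ (1 - q))) (by simpa using h6)
    ENNReal.ofReal_ne_top).1 (le_trans (le_of_eq ?_) h5)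
  rw [← ENNReal.ofReal_mul h6.le]
  congr 1
  have h7 : l ^ (1 - q) * l ^ (q - 1) = 1 := by
    rw [← Real.rpow_add hl0]; simp
  have h8 : l ^ (q - 1) = (1 / (4 * M * K ^ α)) ^ (q - 1) * (N ^ α) ^ (q - 1) := by
    rw [← Real.mul_rpow (by positivity) hNα.le, hl]
    congr 1
    ring
  rw [h8] at h7
  linear_combination (1 / 4) * h7

/-- The upper Marcinkiewicz-Zygmund inequality forces the right volume growth. -/
theorem IsDiffusionMeasureSpace.exists_isRegularMeasure_of_upper_mz
    (hX : IsDiffusionMeasureSpace ρ μ φ ev α) {H : ℝ → ℝ} (hH : IsLowPass H) {q A : ℝ}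
    (hq : 1 ≤ q) (hA : 0 ≤ A) :
    ∃ K M : ℝ, 1 ≤ K ∧ 0 < M ∧ ∀ N : ℝ, 1 ≤ N → ∀ ν : Measure X, SFinite ν →
      (∀ z, ∫⁻ y, ‖filterKernel φ ev H N z y‖ₑ ^ q ∂ν ≤
        ENNReal.ofReal A * ∫⁻ y, ‖filterKernel φ ev H N z y‖ₑ ^ q ∂μ) →
      IsRegularMeasure ρ α K M N ν := by
  obtain ⟨K, c, hK, hc, hlow⟩ := hX.exists_le_setLIntegral_rpow hH hq
  obtain ⟨M, hM, hvol, hreg⟩ := hX.exists_isRegularMeasure_self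
  obtain ⟨C₂, hC₂, hL1⟩ := hX.exists_lintegral_filterKernel_le hH le_rfl hM.le
  obtain ⟨C₁, hC₁, hsup⟩ := hX.filterKernel_localized hH 0
  obtain ⟨κ, hκ, htri⟩ := hX.isQuasiMetric.quasi_triangle
  have hK0 : 0 < K := by linarith
  refine ⟨K, M * (2 * κ) ^ α * (A * (C₁ ^ (q - 1) * C₂)) / c + 1, hK, by positivity,
    fun N hN ν hν hmz x t ht => ?_⟩
  have hN0 : 0 < N := by linarith
  have hNα : 0 < N ^ α := Real.rpow_pos_of_pos hN0 _
  have ht0 : 0 < t := lt_of_lt_of_le (by positivity) ht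
  have hκt : 0 < 2 * κ * t := by positivity
  have hmE := hX.measurableSet_qBall x ht0
  have hmZ := hX.measurableSet_qBall x hκt
  have hmeas : Measurable fun p : X × X => ‖filterKernel φ ev H N p.1 p.2‖ₑ ^ q :=
    ((hX.measurable_filterKernel_uncurry hH hN0).enorm).pow_const q
  have hLq : ∀ z, ∫⁻ y, ‖filterKernel φ ev H N z y‖ₑ ^ q ∂μ ≤
      ENNReal.ofReal ((C₁ * N ^ α) ^ (q - 1) * C₂) := by
    intro z
    rw [ENNReal.ofReal_mul (by positivity)]
    refine le_trans ?_ (mul_le_mul_right (hL1 N hN μ (hreg N hN) z) _)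
    rw [← lintegral_const_mul _ (hX.measurable_filterKernel hH hN0 z).enorm]
    refine lintegral_mono fun y => ?_
    rw [Real.enorm_eq_ofReal_abs]
    set v := |filterKernel φ ev H N z y| with hv
    have hv0 : 0 ≤ v := abs_nonneg _
    have hvb : v ≤ C₁ * N ^ α := by simpa using hsup N hN z y
    rw [ENNReal.ofReal_rpow_of_nonneg hv0 (by linarith), ← ENNReal.ofReal_mul (by positivity)]
    apply ENNReal.ofReal_le_ofReal
    rcases hv0.eq_or_lt with h | h
    · rw [← h, Real.zero_rpow (by linarith), mul_zero]
    · have : v ^ q = v ^ (q - 1) * v := by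
        rw [Real.rpow_sub_one h.ne']; field_simp
      rw [this]
      gcongr
  have hmain : ENNReal.ofReal (c * (N ^ α) ^ (q - 1)) * ν (qBall ρ x t) ≤
      ENNReal.ofReal (M * (2 * κ * t) ^ α * (A * ((C₁ * N ^ α) ^ (q - 1) * C₂))) := by
    calc ENNReal.ofReal (c * (N ^ α) ^ (q - 1)) * ν (qBall ρ x t)
        = ∫⁻ y in qBall ρ x t, ENNReal.ofReal (c * (N ^ α) ^ (q - 1)) ∂ν := by
          rw [setLIntegral_const]
      _ ≤ ∫⁻ y in qBall ρ x t, ∫⁻ z in qBall ρ x (2 * κ * t),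
            ‖filterKernel φ ev H N z y‖ₑ ^ q ∂μ ∂ν := by
          refine setLIntegral_mono' hmE fun y hy => (hlow N hN y).trans ?_
          refine lintegral_mono_set fun z hz => ?_
          have h1 : ρ x y ≤ t := hy
          have h2 : ρ y z ≤ K / N := hz
          refine (htri x y z).trans ?_
          calc κ * (ρ x y + ρ y z) ≤ κ * (t + t) := by gcongr; linarith
            _ = 2 * κ * t := by ring
      _ ≤ ∫⁻ y, ∫⁻ z in qBall ρ x (2 * κ * t), ‖filterKernel φ ev H N z y‖ₑ ^ q ∂μ ∂ν :=
          setLIntegral_le_lintegral _ _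
      _ = ∫⁻ z in qBall ρ x (2 * κ * t), ∫⁻ y, ‖filterKernel φ ev H N z y‖ₑ ^ q ∂ν ∂μ := by
          rw [lintegral_lintegral_swap]
          exact (hmeas.comp measurable_swap).aemeasurable
      _ ≤ ∫⁻ z in qBall ρ x (2 * κ * t),
            ENNReal.ofReal (A * ((C₁ * N ^ α) ^ (q - 1) * C₂)) ∂μ := by
          refine lintegral_mono fun z => (hmz z).trans ?_
          rw [ENNReal.ofReal_mul hA]
          gcongr
          exact hLq z
      _ = ENNReal.ofReal (A * ((C₁ * N ^ α) ^ (q - 1) * C₂)) * μ (qBall ρ x (2 * κ * t)) := by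
          rw [setLIntegral_const]
      _ ≤ ENNReal.ofReal (A * ((C₁ * N ^ α) ^ (q - 1) * C₂)) *
            ENNReal.ofReal (M * (2 * κ * t) ^ α) := by
          gcongr
          exact hvol x _ hκt
      _ = _ := by
          rw [← ENNReal.ofReal_mul (by positivity), mul_comm]
  have hpos : 0 < c * (N ^ α) ^ (q - 1) := by positivity
  refine (ENNReal.mul_le_mul_iff_right (by simpa using hpos) ENNReal.ofReal_ne_top).1
    (hmain.trans ?_)
  rw [← ENNReal.ofReal_mul hpos.le]
  apply ENNReal.ofReal_le_ofReal
  have htα : 0 < t ^ α := Real.rpow_pos_of_pos ht0 _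
  rw [Real.mul_rpow (by positivity) ht0.le, Real.mul_rpow hC₁.le hNα.le]
  calc M * ((2 * κ) ^ α * t ^ α) * (A * (C₁ ^ (q - 1) * (N ^ α) ^ (q - 1) * C₂))
      = c * (N ^ α) ^ (q - 1) * ((M * (2 * κ) ^ α * (A * (C₁ ^ (q - 1) * C₂)) / c) * t ^ α) := by
        field_simp
    _ ≤ _ := by
        gcongr
        linarith

end Diffusion

end

end DiffusionSpace

namespace DiffusionSpace

noncomputable section

theorem isFiniteMeasure_variation {X : Type*} [MeasurableSpace X] (ν : SignedMeasure X) :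
    IsFiniteMeasure ν.variation := by
  rw [← SignedMeasure.totalVariation_eq_variation]
  infer_instance

theorem enorm_vectorIntegral_le {X : Type*} [MeasurableSpace X] (ν : SignedMeasure X) (f : X → ℝ) :
    ‖∫ᵛ x, f x ∂<•ν‖ₑ ≤ ∫⁻ x, ‖f x‖ₑ ∂ν.variation := by
  have := VectorMeasure.enorm_integral_le_lintegral_enorm_transpose (μ := ν) (f := f)
    (B := (ContinuousLinearMap.lsmul ℝ ℝ (E := ℝ)).flip)
  rwa [VectorMeasure.variation_transpose_lsmul_flip] at this

theorem diffPoly_mono {X : Type*} (φ : ℕ → X → ℝ) (ev : ℕ → ℝ) {M N : ℝ} (h : M ≤ N) :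
    diffPoly φ ev M ≤ diffPoly φ ev N :=
  Submodule.span_mono (Set.image_mono fun _ hk => le_trans hk h)

section Diffusion

variable {X : Type*} [TopologicalSpace X] [MeasurableSpace X] [BorelSpace X]
  {ρ : X → X → ℝ} {μ : Measure X} [IsProbabilityMeasure μ] {φ : ℕ → X → ℝ} {ev : ℕ → ℝ} {α : ℝ}

theorem IsDiffusionMeasureSpace.continuous_of_mem_diffPoly
    (hX : IsDiffusionMeasureSpace ρ μ φ ev α) {N : ℝ} {g : X → ℝ} (hg : g ∈ diffPoly φ ev N) :
    Continuous g := by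
  refine Submodule.span_induction (p := fun g _ => Continuous g) ?_ continuous_const
    (fun _ _ _ _ h1 h2 => h1.add h2) (fun c _ _ h => h.const_smul c) hg
  rintro _ ⟨k, -, rfl⟩
  exact hX.continuous k

theorem IsDiffusionMeasureSpace.integrable_of_continuous
    (hX : IsDiffusionMeasureSpace ρ μ φ ev α) {g : X → ℝ} (hg : Continuous g) (ν : Measure X)
    [IsFiniteMeasure ν] : Integrable g ν := by
  have := hX.compactSpace
  obtain ⟨M, hM⟩ := isCompact_univ.exists_bound_of_continuousOn hg.continuousOn
  exact Integrable.of_bound hg.aestronglyMeasurable M (ae_of_all _ fun x => hM x trivial)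

theorem IsDiffusionMeasureSpace.integrable_mul_φ (hX : IsDiffusionMeasureSpace ρ μ φ ev α)
    {ν : Measure X} {f : X → ℝ} (hf : Integrable f ν) (k : ℕ) :
    Integrable (fun y => f y * φ k y) ν := by
  obtain ⟨M, hM⟩ := hX.exists_bound k
  exact hf.mul_bdd (hX.measurable_φ k).aestronglyMeasurable (ae_of_all _ hM)

theorem IsDiffusionMeasureSpace.exists_sigma_eq_sum (hX : IsDiffusionMeasureSpace ρ μ φ ev α)
    {H : ℝ → ℝ} (hH : IsLowPass H) {N : ℝ} (hN : 0 < N) :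
    ∃ m : ℕ, ∀ (f : X → ℝ) (ν : SignedMeasure X) (x : X), sigma φ ev H N f ν x =
      ∑ k ∈ Finset.range m, H (ev k / N) * (∫ᵛ y, f y * φ k y ∂<•ν) * φ k x := by
  obtain ⟨m, hm⟩ := hX.exists_cutoff hH hN
  exact ⟨m, fun f ν x => tsum_eq_sum fun k hk => by rw [hm k hk]; ring⟩

theorem IsDiffusionMeasureSpace.sigma_eq_integral (hX : IsDiffusionMeasureSpace ρ μ φ ev α)
    {H : ℝ → ℝ} (hH : IsLowPass H) {N : ℝ} (hN : 0 < N) {f : X → ℝ} {ν : SignedMeasure X}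
    (hf : Integrable f ν.variation) (x : X) :
    sigma φ ev H N f ν x = ∫ᵛ y, f y * filterKernel φ ev H N x y ∂<•ν := by
  obtain ⟨m, hm, h⟩ := hX.exists_filterKernel_eq_sum hH hN
  have h1 : sigma φ ev H N f ν x =
      ∑ k ∈ Finset.range m, H (ev k / N) * (∫ᵛ y, f y * φ k y ∂<•ν) * φ k x :=
    tsum_eq_sum fun k hk => by rw [hm k hk]; ring
  have h2 : (fun y => f y * filterKernel φ ev H N x y) =
      fun y => ∑ k ∈ Finset.range m, (H (ev k / N) * φ k x) • (f y * φ k y) := by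
    ext y
    rw [h, Finset.mul_sum]
    refine Finset.sum_congr rfl fun k _ => ?_
    rw [smul_eq_mul]
    ring
  rw [h1, h2, VectorMeasure.integral_finsetSum]
  · refine Finset.sum_congr rfl fun k _ => ?_
    rw [VectorMeasure.integral_fun_smul, smul_eq_mul]
    ring
  · intro k _
    exact (hX.integrable_mul_φ hf k).smul (H (ev k / N) * φ k x)

theorem IsDiffusionMeasureSpace.continuous_sigma (hX : IsDiffusionMeasureSpace ρ μ φ ev α)
    {H : ℝ → ℝ} (hH : IsLowPass H) {N : ℝ} (hN : 0 < N) (f : X → ℝ) (ν : SignedMeasure X) :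
    Continuous (sigma φ ev H N f ν) := by
  obtain ⟨m, h⟩ := hX.exists_sigma_eq_sum hH hN
  have : sigma φ ev H N f ν = fun x =>
      ∑ k ∈ Finset.range m, H (ev k / N) * (∫ᵛ y, f y * φ k y ∂<•ν) * φ k x :=
    funext fun x => h f ν x
  rw [this]
  exact continuous_finsetSum _ fun k _ => continuous_const.mul (hX.continuous k)

theorem IsDiffusionMeasureSpace.sigma_mem_diffPoly (hX : IsDiffusionMeasureSpace ρ μ φ ev α)
    {H : ℝ → ℝ} (hH : IsLowPass H) {N : ℝ} (hN : 0 < N) (f : X → ℝ) (ν : SignedMeasure X) :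
    sigma φ ev H N f ν ∈ diffPoly φ ev N := by
  obtain ⟨m, h⟩ := hX.exists_sigma_eq_sum hH hN
  have : sigma φ ev H N f ν =
      ∑ k ∈ Finset.range m, (H (ev k / N) * (∫ᵛ y, f y * φ k y ∂<•ν)) • φ k := by
    ext x
    rw [h]
    simp
  rw [this]
  refine Submodule.sum_mem _ fun k _ => ?_
  rcases le_or_gt (ev k) N with hk | hk
  · exact Submodule.smul_mem _ _ (Submodule.subset_span ⟨k, hk, rfl⟩)
  · rw [hH.eq_zero, zero_mul, zero_smul]
    · exact Submodule.zero_mem _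
    · rw [le_div_iff₀ hN, one_mul]; exact hk.le

theorem IsDiffusionMeasureSpace.sigma_sub (hX : IsDiffusionMeasureSpace ρ μ φ ev α)
    {H : ℝ → ℝ} (hH : IsLowPass H) {N : ℝ} (hN : 0 < N) {f g : X → ℝ} {ν : SignedMeasure X}
    (hf : Integrable f ν.variation) (hg : Integrable g ν.variation) :
    sigma φ ev H N (f - g) ν = sigma φ ev H N f ν - sigma φ ev H N g ν := by
  ext x
  obtain ⟨m, h⟩ := hX.exists_sigma_eq_sum hH hN
  rw [Pi.sub_apply, h, h, h, ← Finset.sum_sub_distrib]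
  refine Finset.sum_congr rfl fun k _ => ?_
  have : ∫ᵛ y, (f - g) y * φ k y ∂<•ν =
      (∫ᵛ y, f y * φ k y ∂<•ν) - ∫ᵛ y, g y * φ k y ∂<•ν := by
    rw [← VectorMeasure.integral_fun_sub (hX.integrable_mul_φ hf k) (hX.integrable_mul_φ hg k)]
    simp only [Pi.sub_apply, sub_mul]
  rw [this]
  ring

theorem IsDiffusionMeasureSpace.enorm_sigma_le (hX : IsDiffusionMeasureSpace ρ μ φ ev α)
    {H : ℝ → ℝ} (hH : IsLowPass H) {N : ℝ} (hN : 0 < N) {f : X → ℝ} {ν : SignedMeasure X}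
    (hf : Integrable f ν.variation) (x : X) :
    ‖sigma φ ev H N f ν x‖ₑ ≤ ∫⁻ y, ‖f y‖ₑ * ‖filterKernel φ ev H N x y‖ₑ ∂ν.variation := by
  rw [hX.sigma_eq_integral hH hN hf]
  refine (enorm_vectorIntegral_le ν _).trans (le_of_eq ?_)
  simp only [enorm_mul]

/-- Quadrature measures reproduce diffusion polynomials. -/
theorem IsDiffusionMeasureSpace.sigma_eq_self (hX : IsDiffusionMeasureSpace ρ μ φ ev α)
    {H : ℝ → ℝ} (hH : IsLowPass H) {a : ℝ} (ha : StrongProduct φ ev a) {n : ℕ}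
    {ν : SignedMeasure X} (hν : IsQuadrature μ φ ev a (2 ^ n) ν) {M : ℝ} (hM : 0 < M)
    (hMn : M ≤ 2 * 2 ^ n) {g : X → ℝ} (hg : g ∈ diffPoly φ ev (M / 2)) :
    sigma φ ev H M g ν = g := by
  ext x
  obtain ⟨m, hm⟩ := hX.exists_cutoff hH hM
  have h1 : sigma φ ev H M g ν x =
      ∑ k ∈ Finset.range m, H (ev k / M) * (∫ y, g y * φ k y ∂μ) * φ k x := by
    rw [sigma, tsum_eq_sum fun k hk => by rw [hm k hk]; ring]
    refine Finset.sum_congr rfl fun k _ => ?_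
    rcases le_or_gt (ev k) M with hk | hk
    · have hgk : g * φ k ∈ diffPoly φ ev (a * 2 ^ n) :=
        ha.2 n g (diffPoly_mono φ ev (by linarith) hg) (φ k)
          (Submodule.subset_span ⟨k, hk.trans hMn, rfl⟩)
      have := hν _ hgk
      simp only [Pi.mul_apply] at this
      rw [this]
    · rw [hH.eq_zero]
      · ring
      · rw [le_div_iff₀ hM, one_mul]; exact hk.le
  rw [h1]
  clear h1
  have hint : ∀ g ∈ diffPoly φ ev (M / 2), ∀ k, Integrable (fun y => g y * φ k y) μ :=
    fun g hg k => hX.integrable_mul_φ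
      (hX.integrable_of_continuous (hX.continuous_of_mem_diffPoly hg) μ) k
  induction hg using Submodule.span_induction with
  | mem g hg =>
    obtain ⟨j, hj, rfl⟩ := hg
    have hj' : ev j ≤ M / 2 := hj
    have hH1 : H (ev j / M) = 1 := by
      refine hH.eq_one _ (div_nonneg (hX.ev_nonneg j) hM.le) ?_
      rw [div_le_iff₀ hM]; linarith
    simp only [hX.integral_mul, mul_ite, mul_one, mul_zero, ite_mul, zero_mul]
    rw [Finset.sum_ite_eq, if_pos, hH1, one_mul]
    by_contra hmem
    rw [hm j hmem] at hH1
    exact zero_ne_one hH1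
  | zero => simp
  | add g₁ g₂ hg₁ hg₂ ih₁ ih₂ =>
    rw [Pi.add_apply, ← ih₁, ← ih₂, ← Finset.sum_add_distrib]
    refine Finset.sum_congr rfl fun k _ => ?_
    simp only [Pi.add_apply, add_mul]
    rw [integral_add (hint _ hg₁ k) (hint _ hg₂ k)]
    ring
  | smul c g hg ih =>
    rw [Pi.smul_apply, ← ih, Finset.smul_sum]
    refine Finset.sum_congr rfl fun k _ => ?_
    simp only [Pi.smul_apply, smul_eq_mul, mul_assoc]
    rw [integral_const_mul]
    ring

/-- Uniform `L₁` boundedness of the summability operators. -/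
theorem IsDiffusionMeasureSpace.exists_lintegral_sigma_le
    (hX : IsDiffusionMeasureSpace ρ μ φ ev α) {H : ℝ → ℝ} (hH : IsLowPass H) :
    ∃ C : ℝ, 0 < C ∧ ∀ N : ℝ, 1 ≤ N → ∀ (ν : SignedMeasure X) (f : X → ℝ),
      Integrable f ν.variation →
      ∫⁻ x, ‖sigma φ ev H N f ν x‖ₑ ∂μ ≤ ENNReal.ofReal C * ∫⁻ y, ‖f y‖ₑ ∂ν.variation := by
  obtain ⟨M, hM, -, hreg⟩ := hX.exists_isRegularMeasure_self
  obtain ⟨C, hC, hL1⟩ := hX.exists_lintegral_filterKernel_le hH le_rfl hM.le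
  refine ⟨C, hC, fun N hN ν f hf => ?_⟩
  have hN0 : 0 < N := by linarith
  have := isFiniteMeasure_variation ν
  calc ∫⁻ x, ‖sigma φ ev H N f ν x‖ₑ ∂μ
      ≤ ∫⁻ x, ∫⁻ y, ‖f y‖ₑ * ‖filterKernel φ ev H N x y‖ₑ ∂ν.variation ∂μ :=
        lintegral_mono fun x => hX.enorm_sigma_le hH hN0 hf x
    _ = ∫⁻ y, ∫⁻ x, ‖f y‖ₑ * ‖filterKernel φ ev H N x y‖ₑ ∂μ ∂ν.variation := by
        rw [lintegral_lintegral_swap]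
        exact (hf.1.comp_snd.enorm).mul
          (hX.measurable_filterKernel_uncurry hH hN0).enorm.aemeasurable
    _ ≤ ∫⁻ y, ENNReal.ofReal C * ‖f y‖ₑ ∂ν.variation := by
        refine lintegral_mono fun y => ?_
        rw [lintegral_const_mul' _ _ enorm_ne_top, mul_comm]
        gcongr
        simp only [filterKernel_comm φ ev H N _ y]
        exact hL1 N hN μ (hreg N hN) y
    _ = _ := lintegral_const_mul' _ _ ENNReal.ofReal_ne_top

theorem IsDiffusionMeasureSpace.diffPoly_le_of_strongProduct
    (hX : IsDiffusionMeasureSpace ρ μ φ ev α) {a : ℝ} (ha : StrongProduct φ ev a) (n : ℕ) :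
    diffPoly φ ev (2 * 2 ^ n) ≤ diffPoly φ ev (a * 2 ^ n) := by
  intro g hg
  have h0 : φ 0 ∈ diffPoly φ ev (2 ^ n) := by
    refine Submodule.subset_span ⟨0, ?_, rfl⟩
    change ev 0 ≤ 2 ^ n
    rw [hX.ev_zero]
    positivity
  have h1 : φ 0 * g = g := by
    ext x
    simp [hX.φ_zero]
  rw [← h1]
  exact ha.2 n _ h0 g hg

/-- Marcinkiewicz-Zygmund quadrature measures have the right volume growth. -/
theorem IsDiffusionMeasureSpace.exists_isRegularMeasure_of_isUniformMZQuadrature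
    (hX : IsDiffusionMeasureSpace ρ μ φ ev α) {H : ℝ → ℝ} (hH : IsLowPass H)
    {a : ℝ} (ha : StrongProduct φ ev a) {p : ℝ≥0∞} (hp : 1 ≤ p) {ν : ℕ → SignedMeasure X}
    (hν : IsUniformMZQuadrature μ φ ev a p ν) :
    ∃ K M : ℝ, 1 ≤ K ∧ 0 < M ∧ ∀ n, IsRegularMeasure ρ α K M (2 ^ n) (ν n).variation := by
  obtain ⟨q, A, hq, hA, hmz⟩ : ∃ q A : ℝ, 1 ≤ q ∧ 0 < A ∧ ∀ n, ∀ f ∈ diffPoly φ ev (a * 2 ^ n),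
      (∫⁻ y, ‖f y‖ₑ ^ q ∂(ν n).variation) ≤ ENNReal.ofReal A * ∫⁻ y, ‖f y‖ₑ ^ q ∂μ := by
    by_cases hptop : p = ∞
    · obtain ⟨A, hA, h⟩ := hν.mz_one hptop
      refine ⟨1, A, le_rfl, hA, fun n f hf => ?_⟩
      simpa [eLpNorm_one_eq_lintegral_enorm] using h n f hf
    · obtain ⟨_, A, -, hA, h⟩ := hν.mz
      have hp0 : p ≠ 0 := (zero_lt_one.trans_le hp).ne'
      have hq : 1 ≤ p.toReal := by
        rw [← ENNReal.toReal_one]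
        exact (ENNReal.toReal_le_toReal ENNReal.one_ne_top hptop).2 hp
      refine ⟨p.toReal, A ^ p.toReal, hq, by positivity, fun n f hf => ?_⟩
      have h1 := (h n f hf).2
      rw [eLpNorm_eq_lintegral_rpow_enorm_toReal hp0 hptop,
        eLpNorm_eq_lintegral_rpow_enorm_toReal hp0 hptop] at h1
      have h2 := ENNReal.rpow_le_rpow h1 (by linarith : 0 ≤ p.toReal)
      rw [ENNReal.mul_rpow_of_nonneg _ _ (by linarith), ← ENNReal.rpow_mul, ← ENNReal.rpow_mul,
        one_div_mul_cancel (by linarith), ENNReal.rpow_one, ENNReal.rpow_one,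
        ENNReal.ofReal_rpow_of_pos hA] at h2
      exact h2
  obtain ⟨K, M, hK, hM, h⟩ := hX.exists_isRegularMeasure_of_upper_mz hH hq hA.le
  refine ⟨K, M, hK, hM, fun n => ?_⟩
  have := isFiniteMeasure_variation (ν n)
  have h2n : (1 : ℝ) ≤ 2 ^ n := one_le_pow₀ one_le_two
  refine h (2 ^ n) h2n _ inferInstance fun z => hmz n _ ?_
  refine hX.diffPoly_le_of_strongProduct ha n (diffPoly_mono φ ev (by linarith)
    (hX.filterKernel_mem_diffPoly hH (by positivity) z))

theorem IsDiffusionMeasureSpace.exists_measure_univ_le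
    (hX : IsDiffusionMeasureSpace ρ μ φ ev α) {K M : ℝ} (hK : 1 ≤ K) (hM : 0 < M) :
    ∃ C : ℝ, 0 < C ∧ ∀ N : ℝ, 1 ≤ N → ∀ ν : Measure X, IsRegularMeasure ρ α K M N ν →
      ν Set.univ ≤ ENNReal.ofReal C := by
  obtain ⟨D, hD1, hD⟩ := hX.exists_diam
  have : Nonempty X := nonempty_of_isProbabilityMeasure μ
  obtain ⟨x₀⟩ := this
  refine ⟨M * (max D K) ^ α, by positivity, fun N hN ν hν => ?_⟩
  have hU : qBall ρ x₀ (max D K) = Set.univ :=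
    Set.eq_univ_of_forall fun y => (hD x₀ y).trans (le_max_left _ _)
  rw [← hU]
  refine hν x₀ _ ((div_le_self (by linarith) hN).trans (le_max_right _ _))

end Diffusion

end

end DiffusionSpace

namespace DiffusionSpace

noncomputable section

section Diffusion

variable {X : Type*} [TopologicalSpace X] [MeasurableSpace X] [BorelSpace X]
  {ρ : X → X → ℝ} {μ : Measure X} [IsProbabilityMeasure μ] {φ : ℕ → X → ℝ} {ev : ℕ → ℝ} {α : ℝ}

/-- Integrals of `L_p` functions (continuous ones if `p = ∞`) against the measures of a family
are controlled by the `L_p(μ)` norm. -/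
def IsSamplingFamily {X : Type*} [TopologicalSpace X] [MeasurableSpace X] (μ : Measure X)
    (p : ℝ≥0∞) (C : ℝ) (m : ℕ → SignedMeasure X) : Prop :=
  ∀ (n : ℕ) (h : X → ℝ), MemLp h p μ → (p = ∞ → Continuous h) →
    Integrable h (m n).variation ∧
      ∫⁻ y, ‖h y‖ₑ ∂(m n).variation ≤ ENNReal.ofReal C * eLpNorm h p μ

theorem IsDiffusionMeasureSpace.exists_isSamplingFamily
    (hX : IsDiffusionMeasureSpace ρ μ φ ev α) {H : ℝ → ℝ} (hH : IsLowPass H)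
    {a : ℝ} (ha : StrongProduct φ ev a) {p : ℝ≥0∞} (hp : 1 ≤ p) {m : ℕ → SignedMeasure X}
    (hm_top : p = ∞ → IsUniformMZQuadrature μ φ ev a p m)
    (hm_lt : p ≠ ∞ → ∀ n, m n = μ.toSignedMeasure) :
    (∀ n, IsQuadrature μ φ ev a (2 ^ n) (m n)) ∧ ∃ C : ℝ, 0 < C ∧ IsSamplingFamily μ p C m := by
  by_cases hpt : p = ∞
  · have hmz := hm_top hpt
    refine ⟨hmz.quadrature, ?_⟩
    obtain ⟨K, M, hK, hM, hreg⟩ :=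
      hX.exists_isRegularMeasure_of_isUniformMZQuadrature hH ha hp hmz
    obtain ⟨C, hC, hmass⟩ := hX.exists_measure_univ_le hK hM
    refine ⟨C, hC, fun n h _ hcont => ?_⟩
    have hfin := isFiniteMeasure_variation (m n)
    refine ⟨hX.integrable_of_continuous (hcont hpt) _, ?_⟩
    have h2n : (1 : ℝ) ≤ 2 ^ n := one_le_pow₀ one_le_two
    calc ∫⁻ y, ‖h y‖ₑ ∂(m n).variation ≤ ∫⁻ _, eLpNorm h p μ ∂(m n).variation := by
          refine lintegral_mono fun y => ?_
          rw [hpt]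
          exact hX.enorm_le_eLpNorm_top (hcont hpt) y
      _ = eLpNorm h p μ * (m n).variation Set.univ := lintegral_const _
      _ ≤ _ := by
          rw [mul_comm]
          gcongr
          exact hmass _ h2n _ (hreg n)
  · have hm := hm_lt hpt
    refine ⟨fun n f _ => by rw [hm, VectorMeasure.integral_toSignedMeasure], 1, one_pos,
      fun n h hh _ => ?_⟩
    rw [hm, Measure.variation_toSignedMeasure, ENNReal.ofReal_one, one_mul,
      ← eLpNorm_one_eq_lintegral_enorm]
    exact ⟨hh.integrable hp, eLpNorm_le_eLpNorm_of_exponent_le hp hh.1⟩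

theorem IsDiffusionMeasureSpace.tendsto_eLpNorm_sigma_sub
    (hX : IsDiffusionMeasureSpace ρ μ φ ev α) {H : ℝ → ℝ} (hH : IsLowPass H)
    {a : ℝ} (ha : StrongProduct φ ev a) {p : ℝ≥0∞} (hp : 1 ≤ p) {m : ℕ → SignedMeasure X}
    (hquad : ∀ n, IsQuadrature μ φ ev a (2 ^ n) (m n)) {C : ℝ}
    (hsamp : IsSamplingFamily μ p C m) {f : X → ℝ} (hf : MemX μ φ ev p f) :
    Tendsto (fun n => eLpNorm (sigma φ ev H (2 ^ n) f (m n) - f) 1 μ) atTop (𝓝 0) := by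
  obtain ⟨C₁, hC₁, hL1⟩ := hX.exists_lintegral_sigma_le hH
  obtain ⟨hfLp, hfc, happ⟩ := hf
  rw [ENNReal.tendsto_nhds_zero]
  intro e he
  set D : ℝ≥0∞ := ENNReal.ofReal C₁ * ENNReal.ofReal C + 1 with hD
  have hDtop : D ≠ ∞ := by simp [hD, ENNReal.mul_eq_top]
  have hD0 : D ≠ 0 := by simp [hD]
  obtain ⟨N, g, hg, hfg⟩ := happ (e / D) (ENNReal.div_pos he.ne' hDtop)
  have hgc := hX.continuous_of_mem_diffPoly hg
  have hgLp : MemLp g p μ := by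
    have := hX.compactSpace
    obtain ⟨B, hB⟩ := isCompact_univ.exists_bound_of_continuousOn hgc.continuousOn
    exact MemLp.of_bound hgc.aestronglyMeasurable B (ae_of_all _ fun x => hB x trivial)
  obtain ⟨n₀, hn₀⟩ := pow_unbounded_of_one_lt (2 * N) (one_lt_two : (1 : ℝ) < 2)
  filter_upwards [eventually_ge_atTop n₀] with n hn
  have h2n : (1 : ℝ) ≤ 2 ^ n := one_le_pow₀ one_le_two
  have hNn : N ≤ 2 ^ n / 2 := by
    have : (2 : ℝ) ^ n₀ ≤ 2 ^ n := pow_le_pow_right₀ one_le_two hn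
    linarith
  have hself := hX.sigma_eq_self hH ha (hquad n) (M := 2 ^ n) (by positivity) (by linarith)
    (diffPoly_mono φ ev hNn hg)
  obtain ⟨hif, -⟩ := hsamp n f hfLp hfc
  obtain ⟨hig, -⟩ := hsamp n g hgLp fun _ => hgc
  obtain ⟨hi, hle⟩ := hsamp n (f - g) (hfLp.sub hgLp) fun h => (hfc h).sub hgc
  have hsub := hX.sigma_sub hH (N := 2 ^ n) (by positivity) hif hig
  have heq : sigma φ ev H (2 ^ n) f (m n) - f =
      sigma φ ev H (2 ^ n) (f - g) (m n) - (f - g) := by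
    rw [hsub, hself]
    abel
  rw [heq]
  calc eLpNorm (sigma φ ev H (2 ^ n) (f - g) (m n) - (f - g)) 1 μ
      ≤ eLpNorm (sigma φ ev H (2 ^ n) (f - g) (m n)) 1 μ + eLpNorm (f - g) 1 μ :=
        eLpNorm_sub_le (hX.continuous_sigma hH (by positivity) _ _).aestronglyMeasurable
          (hfLp.sub hgLp).1 le_rfl
    _ ≤ ENNReal.ofReal C₁ * (ENNReal.ofReal C * eLpNorm (f - g) p μ) + eLpNorm (f - g) p μ := by
        gcongr
        · rw [eLpNorm_one_eq_lintegral_enorm]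
          refine (hL1 _ h2n _ _ hi).trans ?_
          gcongr
        · exact eLpNorm_le_eLpNorm_of_exponent_le hp (hfLp.sub hgLp).1
    _ = D * eLpNorm (f - g) p μ := by rw [hD]; ring
    _ ≤ D * (e / D) := by gcongr
    _ = e := ENNReal.mul_div_cancel hD0 hDtop

theorem sum_rpow_two_le {s : ℝ} (hs : 0 < s) (n k : ℕ) :
    ∑ j ∈ Finset.range k, ((2 : ℝ) ^ (n + j + 1)) ^ (-s) ≤
      1 / (1 - 2 ^ (-s)) * ((2 : ℝ) ^ n) ^ (-s) := by
  have h1 : (2 : ℝ) ^ (-s) < 1 := Real.rpow_lt_one_of_one_lt_of_neg one_lt_two (by linarith)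
  have h0 : 0 < (2 : ℝ) ^ (-s) := by positivity
  have e : ∀ i : ℕ, ((2 : ℝ) ^ i) ^ (-s) = ((2 : ℝ) ^ (-s)) ^ i := fun i => by
    rw [← Real.rpow_natCast, ← Real.rpow_natCast, ← Real.rpow_mul (by norm_num),
      ← Real.rpow_mul (by norm_num), mul_comm]
  calc ∑ j ∈ Finset.range k, ((2 : ℝ) ^ (n + j + 1)) ^ (-s)
      ≤ ∑ j ∈ Finset.range k, ((2 : ℝ) ^ (-s)) ^ n * ((2 : ℝ) ^ (-s)) ^ j := by
        refine Finset.sum_le_sum fun j _ => ?_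
        rw [e, ← pow_add]
        exact pow_le_pow_of_le_one h0.le h1.le (by omega)
    _ ≤ ((2 : ℝ) ^ (-s)) ^ n * (1 - 2 ^ (-s))⁻¹ := by
        rw [← Finset.mul_sum]
        gcongr
        rw [← tsum_geometric_of_lt_one h0.le h1]
        exact (summable_geometric_of_lt_one h0.le h1).sum_le_tsum _ fun _ _ => by positivity
    _ = _ := by rw [e, one_div, mul_comm]

/-- On `B`, functions of the local Sobolev ball are approximated by `σ_N(f, μ_N)`. -/
theorem IsDiffusionMeasureSpace.eLpNorm_sub_sigma_le
    (hX : IsDiffusionMeasureSpace ρ μ φ ev α) {H : ℝ → ℝ} (hH : IsLowPass H)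
    {a : ℝ} (ha : StrongProduct φ ev a) {p : ℝ≥0∞} (hp : 1 ≤ p) {m : ℕ → SignedMeasure X}
    (hquad : ∀ n, IsQuadrature μ φ ev a (2 ^ n) (m n)) {C : ℝ}
    (hsamp : IsSamplingFamily μ p C m) {s : ℝ} (hs : 0 < s) {B : Set X} {r : ℝ} (hr : 0 ≤ r)
    {f : X → ℝ} (hf : f ∈ localSobolevBall μ φ ev H m s p B r) (n : ℕ) :
    eLpNorm (f - sigma φ ev H (2 ^ n) f (m n)) p (μ.restrict B) ≤
      ENNReal.ofReal (1 / (1 - 2 ^ (-s)) * r * ((2 : ℝ) ^ n) ^ (-s)) := by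
  obtain ⟨hfX, hfnorm⟩ := hf
  set P : ℕ → X → ℝ := fun k => sigma φ ev H (2 ^ k) f (m k) with hP
  have hPm : ∀ k, AEStronglyMeasurable (P k) μ := fun k =>
    (hX.continuous_sigma hH (by positivity) _ _).aestronglyMeasurable
  have hτ : ∀ k, eLpNorm (P (k + 1) - P k) p (μ.restrict B) ≤
      ENNReal.ofReal (r * ((2 : ℝ) ^ (k + 1)) ^ (-s)) := by
    intro k
    have h1 : ENNReal.ofReal (((2 : ℝ) ^ (k + 1)) ^ s) *
        eLpNorm (P (k + 1) - P k) p (μ.restrict B) ≤ ENNReal.ofReal r :=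
      ((le_iSup (fun k : ℕ => ENNReal.ofReal (((2 : ℝ) ^ (k + 1)) ^ s) *
        eLpNorm (P (k + 1) - P k) p (μ.restrict B)) k).trans le_add_self).trans hfnorm
    have hpos : 0 < ((2 : ℝ) ^ (k + 1)) ^ s := by positivity
    refine (ENNReal.mul_le_mul_iff_right (a := ENNReal.ofReal (((2 : ℝ) ^ (k + 1)) ^ s))
      (by simpa using hpos) ENNReal.ofReal_ne_top).1 (h1.trans (le_of_eq ?_))
    rw [← ENNReal.ofReal_mul hpos.le, Real.rpow_neg (by positivity)]
    congr 1
    field_simp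
  have htel : ∀ k, eLpNorm (P (n + k) - P n) p (μ.restrict B) ≤
      ENNReal.ofReal (∑ j ∈ Finset.range k, r * ((2 : ℝ) ^ (n + j + 1)) ^ (-s)) := by
    intro k
    induction k with
    | zero => simp
    | succ k ih =>
      have e : P (n + (k + 1)) - P n = (P (n + k + 1) - P (n + k)) + (P (n + k) - P n) := by
        rw [← add_assoc]; abel
      rw [e, Finset.sum_range_succ, add_comm (∑ j ∈ Finset.range k, _),
        ENNReal.ofReal_add (by positivity) (Finset.sum_nonneg fun _ _ => by positivity)]
      exact (eLpNorm_add_le (((hPm _).sub (hPm _)).mono_measure Measure.restrict_le_self)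
        (((hPm _).sub (hPm _)).mono_measure Measure.restrict_le_self) hp).trans
        (add_le_add (hτ _) ih)
  have hbound : ∀ k, n ≤ k → eLpNorm (P k - P n) p (μ.restrict B) ≤
      ENNReal.ofReal (1 / (1 - 2 ^ (-s)) * r * ((2 : ℝ) ^ n) ^ (-s)) := by
    intro k hk
    obtain ⟨j, rfl⟩ := Nat.exists_eq_add_of_le hk
    refine (htel j).trans (ENNReal.ofReal_le_ofReal ?_)
    rw [← Finset.mul_sum]
    calc r * _ ≤ r * (1 / (1 - 2 ^ (-s)) * ((2 : ℝ) ^ n) ^ (-s)) :=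
          mul_le_mul_of_nonneg_left (sum_rpow_two_le hs n j) hr
      _ = _ := by ring
  have hmeas := tendstoInMeasure_of_tendsto_eLpNorm one_ne_zero hPm hfX.1.1
    (hX.tendsto_eLpNorm_sigma_sub hH ha hp hquad hsamp hfX)
  obtain ⟨ns, hns, hlim⟩ := hmeas.exists_seq_tendsto_ae
  have hlim' : ∀ᵐ x ∂μ.restrict B,
      Tendsto (fun i => (P (ns i) - P n) x) atTop (𝓝 ((f - P n) x)) := by
    filter_upwards [ae_restrict_of_ae hlim] with x hx
    exact hx.sub_const _
  refine (Lp.eLpNorm_lim_le_liminf_eLpNorm (p := p)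
    (fun i => ((hPm (ns i)).sub (hPm n)).mono_measure Measure.restrict_le_self) _ hlim').trans ?_
  refine liminf_le_of_frequently_le' (Eventually.frequently ?_)
  filter_upwards [eventually_ge_atTop n] with i hi
  exact hbound _ (hi.trans (hns.id_le i))

theorem IsDiffusionMeasureSpace.exists_enorm_sigma_le
    (hX : IsDiffusionMeasureSpace ρ μ φ ev α) {H : ℝ → ℝ} (hH : IsLowPass H) :
    ∃ C : ℝ, 0 < C ∧ ∀ N : ℝ, 1 ≤ N → ∀ (ν : SignedMeasure X) (f : X → ℝ),
      Integrable f ν.variation → ∀ x, ‖sigma φ ev H N f ν x‖ₑ ≤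
        ENNReal.ofReal (C * N ^ α) * ∫⁻ y, ‖f y‖ₑ ∂ν.variation := by
  obtain ⟨C, hC, h⟩ := hX.filterKernel_localized hH 0
  refine ⟨C, hC, fun N hN ν f hf x => ?_⟩
  refine (hX.enorm_sigma_le hH (by linarith) hf x).trans ?_
  rw [← lintegral_const_mul' _ _ ENNReal.ofReal_ne_top]
  refine lintegral_mono fun y => ?_
  rw [mul_comm]
  gcongr
  rw [Real.enorm_eq_ofReal_abs]
  apply ENNReal.ofReal_le_ofReal
  simpa using h N hN x y

/-- Pointwise bound for `σ_N(f, μ_N)` on the local Sobolev ball. -/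
theorem IsDiffusionMeasureSpace.exists_abs_sigma_le
    (hX : IsDiffusionMeasureSpace ρ μ φ ev α) {H : ℝ → ℝ} (hH : IsLowPass H)
    {p : ℝ≥0∞} {m : ℕ → SignedMeasure X} {C : ℝ} (hC : 0 < C)
    (hsamp : IsSamplingFamily μ p C m) (s : ℝ) (B : Set X) :
    ∃ A : ℝ, 0 < A ∧ ∀ r : ℝ, 0 ≤ r → ∀ f ∈ localSobolevBall μ φ ev H m s p B r, ∀ (n : ℕ) (x : X),
      |sigma φ ev H (2 ^ n) f (m n) x| ≤ A * r * ((2 : ℝ) ^ n) ^ α := by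
  obtain ⟨C₁, hC₁, h⟩ := hX.exists_enorm_sigma_le hH
  refine ⟨C₁ * C, by positivity, fun r hr f hf n x => ?_⟩
  obtain ⟨⟨hfLp, hfc, -⟩, hnorm⟩ := hf
  have hfr : eLpNorm f p μ ≤ ENNReal.ofReal r := le_self_add.trans hnorm
  obtain ⟨hi, hle⟩ := hsamp n f hfLp hfc
  have h2n : (1 : ℝ) ≤ 2 ^ n := one_le_pow₀ one_le_two
  have h1 := h _ h2n _ _ hi x
  rw [Real.enorm_eq_ofReal_abs] at h1
  have h2 : ENNReal.ofReal |sigma φ ev H (2 ^ n) f (m n) x| ≤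
      ENNReal.ofReal (C₁ * C * r * ((2 : ℝ) ^ n) ^ α) := by
    refine h1.trans ?_
    calc _ ≤ ENNReal.ofReal (C₁ * ((2 : ℝ) ^ n) ^ α) * (ENNReal.ofReal C * ENNReal.ofReal r) := by
          gcongr
          exact hle.trans (by gcongr)
      _ = _ := by
          rw [← ENNReal.ofReal_mul hC.le, ← ENNReal.ofReal_mul (by positivity)]
          congr 1
          ring
  exact (ENNReal.ofReal_le_ofReal_iff (by positivity)).1 h2

/-- Distance between the inner ball and the complement of the outer one. -/
theorem IsDiffusionMeasureSpace.exists_separation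
    (hX : IsDiffusionMeasureSpace ρ μ φ ev α) {ψ : X → ℝ} (hψ : Continuous ψ) {B' B : Set X}
    (hB' : IsCompact B') (h1 : ∀ y ∈ B', ψ y = 1) (h0 : ∀ y ∉ B, ψ y = 0) :
    ∃ δ : ℝ, 0 < δ ∧ ∀ x ∈ B', ∀ y ∉ B, δ ≤ ρ x y := by
  obtain ⟨κ, hκ, htri⟩ := hX.isQuasiMetric.quasi_triangle
  have hκ0 : 0 < κ := by linarith
  have hloc : ∀ x ∈ B', ∃ t : ℝ, 0 < t ∧ ∀ y, ρ x y < t → ψ y ≠ 0 := by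
    intro x hx
    have hnhds : {y | ψ y ≠ 0} ∈ 𝓝 x := by
      refine (isOpen_ne_fun hψ continuous_const).mem_nhds ?_
      change ψ x ≠ 0
      rw [h1 x hx]
      exact one_ne_zero
    obtain ⟨t, ht, hsub⟩ := (hX.isQuasiMetric.nhds_basis x).mem_iff.1 hnhds
    exact ⟨t, ht, fun y hy => hsub hy⟩
  refine hB'.induction_on (p := fun S => ∃ δ : ℝ, 0 < δ ∧ ∀ x ∈ S, ∀ y ∉ B, δ ≤ ρ x y)
    ⟨1, one_pos, fun x hx => hx.elim⟩ ?_ ?_ ?_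
  · rintro S T hST ⟨δ, hδ, h⟩
    exact ⟨δ, hδ, fun x hx => h x (hST hx)⟩
  · rintro S T ⟨δ, hδ, h⟩ ⟨δ', hδ', h'⟩
    refine ⟨min δ δ', lt_min hδ hδ', fun x hx y hy => ?_⟩
    rcases hx with hx | hx
    · exact (min_le_left _ _).trans (h x hx y hy)
    · exact (min_le_right _ _).trans (h' x hx y hy)
  · intro x hx
    obtain ⟨t, ht, hne⟩ := hloc x hx
    have ht' : 0 < t / (2 * κ) := by positivity
    refine ⟨_, mem_nhdsWithin_of_mem_nhds ((hX.isQuasiMetric.nhds_basis x).mem_of_mem ht'),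
      t / (2 * κ), ht', fun z hz y hy => ?_⟩
    by_contra hlt
    rw [not_le] at hlt
    refine hne y ?_ (h0 y hy)
    have hz' : ρ x z < t / (2 * κ) := hz
    calc ρ x y ≤ κ * (ρ x z + ρ z y) := htri x z y
      _ < κ * (t / (2 * κ) + t / (2 * κ)) := by gcongr
      _ = t := by field_simp; ring

end Diffusion

end

end DiffusionSpace

namespace DiffusionSpace

noncomputable section

section Diffusion

variable {X : Type*} [TopologicalSpace X] [MeasurableSpace X] [BorelSpace X]
  {ρ : X → X → ℝ} {μ : Measure X} [IsProbabilityMeasure μ] {φ : ℕ → X → ℝ} {ev : ℕ → ℝ} {α : ℝ}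

theorem IsDiffusionMeasureSpace.continuous_sigmaQuant (hX : IsDiffusionMeasureSpace ρ μ φ ev α)
    {H : ℝ → ℝ} (hH : IsLowPass H) {N : ℝ} (hN : 0 < N) (S : ℝ) (f : X → ℝ)
    (ν₁ ν₂ : SignedMeasure X) (B : Set X) :
    Continuous (sigmaQuant φ ev H S N f ν₁ ν₂ B) :=
  continuous_const.mul (hX.continuous_sigma hH (by positivity : 0 < 2 * N)
    (fun y => (quantized φ ev H S N f ν₁ y : ℝ)) (ν₂.restrict B))

theorem IsDiffusionMeasureSpace.integrable_quantized (hX : IsDiffusionMeasureSpace ρ μ φ ev α)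
    {H : ℝ → ℝ} (hH : IsLowPass H) {N : ℝ} (hN : 0 < N) (S : ℝ) (f : X → ℝ)
    (ν₁ : SignedMeasure X) (ν : Measure X) [IsFiniteMeasure ν] :
    Integrable (fun y => (quantized φ ev H S N f ν₁ y : ℝ)) ν := by
  have hc : Continuous fun y => N ^ S * sigma φ ev H N f ν₁ y :=
    continuous_const.mul (hX.continuous_sigma hH hN f ν₁)
  have h1 : Integrable (fun y => Int.fract (N ^ S * sigma φ ev H N f ν₁ y)) ν := by
    refine Integrable.of_bound (measurable_fract.comp hc.measurable).aestronglyMeasurable 1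
      (ae_of_all _ fun y => ?_)
    rw [Real.norm_of_nonneg (Int.fract_nonneg _)]
    exact (Int.fract_lt_one _).le
  refine ((hX.integrable_of_continuous hc ν).sub h1).congr (ae_of_all _ fun y => ?_)
  simp [quantized, Int.self_sub_fract]

theorem abs_sub_quantized_le {X : Type*} [MeasurableSpace X] (φ : ℕ → X → ℝ) (ev : ℕ → ℝ)
    (H : ℝ → ℝ) (S : ℝ) {N : ℝ} (hN : 0 < N) (f : X → ℝ) (ν : SignedMeasure X) (y : X) :
    |sigma φ ev H N f ν y - N ^ (-S) * (quantized φ ev H S N f ν y : ℝ)| ≤ N ^ (-S) := by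
  have hpos : 0 < N ^ S := Real.rpow_pos_of_pos hN _
  have e : sigma φ ev H N f ν y - N ^ (-S) * (quantized φ ev H S N f ν y : ℝ) =
      N ^ (-S) * Int.fract (N ^ S * sigma φ ev H N f ν y) := by
    rw [quantized, Int.fract, Real.rpow_neg hN.le]
    field_simp
  rw [e, abs_of_nonneg (mul_nonneg (Real.rpow_nonneg hN.le _) (Int.fract_nonneg _))]
  exact mul_le_of_le_one_right (Real.rpow_nonneg hN.le _) (Int.fract_lt_one _).le

theorem integral_restrict_sub {X : Type*} [MeasurableSpace X] (ν : SignedMeasure X) {B : Set X}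
    {F G : X → ℝ} (hF : Integrable F (ν.restrict B).variation)
    (hG : Integrable G (ν.restrict B).variation) :
    (∫ᵛ y in B, F y - G y ∂<•ν) = (∫ᵛ y in B, F y ∂<•ν) - ∫ᵛ y in B, G y ∂<•ν :=
  VectorMeasure.integral_fun_sub hF hG

/-- Splitting of the quantization error at a point. -/
theorem IsDiffusionMeasureSpace.enorm_sigma_sub_sigmaQuant_le
    (hX : IsDiffusionMeasureSpace ρ μ φ ev α) {H : ℝ → ℝ} (hH : IsLowPass H)
    {N : ℝ} (hN : 0 < N) {ν : SignedMeasure X}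
    (hν : ∀ g ∈ diffPoly φ ev N, sigma φ ev H (2 * N) g ν = g) (S : ℝ) (f : X → ℝ) (m : SignedMeasure X)
    {B : Set X} (hB : MeasurableSet B) (x : X) :
    ‖sigma φ ev H N f m x - sigmaQuant φ ev H S N f m ν B x‖ₑ ≤
      (∫⁻ y in Bᶜ, ‖sigma φ ev H N f m y‖ₑ * ‖filterKernel φ ev H (2 * N) x y‖ₑ
        ∂ν.variation) +
      ENNReal.ofReal (N ^ (-S)) *
        ∫⁻ y, ‖filterKernel φ ev H (2 * N) x y‖ₑ ∂ν.variation := by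
  have h2N : 0 < 2 * N := by positivity
  have hfin := isFiniteMeasure_variation ν
  have hfinB := isFiniteMeasure_variation (ν.restrict B)
  set P := sigma φ ev H N f m with hP
  set I : X → ℝ := fun y => (quantized φ ev H S N f m y : ℝ) with hI
  set k := filterKernel φ ev H (2 * N) x with hk
  have hPmem : P ∈ diffPoly φ ev N := hX.sigma_mem_diffPoly hH hN f m
  have hPc : Continuous P := hX.continuous_sigma hH hN f m
  have hkc : Continuous k := hX.continuous_of_mem_diffPoly (hX.filterKernel_mem_diffPoly hH h2N x)
  have hPk : Integrable (fun y => P y * k y) ν.variation :=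
    hX.integrable_of_continuous (hPc.mul hkc) _
  have hPkB : Integrable (fun y => P y * k y) (ν.restrict B).variation :=
    hX.integrable_of_continuous (hPc.mul hkc) _
  have hIB : Integrable I (ν.restrict B).variation := hX.integrable_quantized hH hN S f m _
  have hIk : Integrable (fun y => I y * k y) (ν.restrict B).variation := by
    have := hX.compactSpace
    obtain ⟨M, hM⟩ := isCompact_univ.exists_bound_of_continuousOn hkc.continuousOn
    exact hIB.mul_bdd hkc.aestronglyMeasurable (ae_of_all _ fun y => hM y trivial)
  have e1 : P x = (∫ᵛ y in B, P y * k y ∂<•ν) + ∫ᵛ y in Bᶜ, P y * k y ∂<•ν := by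
    rw [VectorMeasure.setIntegral_add_compl hB hPk, ← hX.sigma_eq_integral hH h2N
      (hX.integrable_of_continuous hPc _), hν P hPmem]
  have e2 : sigmaQuant φ ev H S N f m ν B x =
      ∫ᵛ y in B, N ^ (-S) • (I y * k y) ∂<•ν := by
    rw [VectorMeasure.integral_fun_smul, smul_eq_mul]
    change N ^ (-S) * sigma φ ev H (2 * N) I (ν.restrict B) x = _
    rw [hX.sigma_eq_integral hH h2N hIB x]
  have hsm : Integrable (fun y => N ^ (-S) • (I y * k y)) (ν.restrict B).variation :=
    Integrable.const_mul hIk (N ^ (-S))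
  have e3 : P x - sigmaQuant φ ev H S N f m ν B x = (∫ᵛ y in Bᶜ, P y * k y ∂<•ν) +
      ∫ᵛ y in B, (P y * k y - N ^ (-S) • (I y * k y)) ∂<•ν := by
    rw [e1, e2, integral_restrict_sub ν hPkB hsm]
    generalize (∫ᵛ y in B, P y * k y ∂<•ν) = u
    generalize (∫ᵛ y in Bᶜ, P y * k y ∂<•ν) = v
    generalize (∫ᵛ y in B, N ^ (-S) • (I y * k y) ∂<•ν) = w
    abel
  rw [e3]
  refine (enorm_add_le _ _).trans (add_le_add ?_ ?_)
  · refine (enorm_vectorIntegral_le _ _).trans (le_of_eq ?_)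
    rw [VectorMeasure.variation_restrict hB.compl]
    simp only [enorm_mul]
  · refine (enorm_vectorIntegral_le _ _).trans ?_
    rw [VectorMeasure.variation_restrict hB, ← lintegral_const_mul' _ _ ENNReal.ofReal_ne_top]
    refine (setLIntegral_le_lintegral _ _).trans (lintegral_mono fun y => ?_)
    have : P y * k y - N ^ (-S) • (I y * k y) =
        (P y - N ^ (-S) * I y) * k y := by
      rw [smul_eq_mul]; ring
    rw [this, enorm_mul]
    gcongr
    rw [Real.enorm_eq_ofReal_abs]
    exact ENNReal.ofReal_le_ofReal (abs_sub_quantized_le φ ev H S hN f m y)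

/-- Uniform estimate of the quantization error on a set separated from the complement of `B`. -/
theorem IsDiffusionMeasureSpace.exists_abs_sigma_sub_sigmaQuant_le
    (hX : IsDiffusionMeasureSpace ρ μ φ ev α) {H : ℝ → ℝ} (hH : IsLowPass H)
    {a : ℝ} (ha : StrongProduct φ ev a) {ν : ℕ → SignedMeasure X}
    (hν : ∀ n, IsQuadrature μ φ ev a (2 ^ n) (ν n)) {K M : ℝ} (hK : 1 ≤ K) (hM : 0 < M)
    (hreg : ∀ n, IsRegularMeasure ρ α K M (2 ^ n) (ν n).variation)
    {s S : ℝ} (hsS : s ≤ S) {B' B : Set X} (hB : MeasurableSet B) {δ : ℝ} (hδ : 0 < δ)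
    (hsep : ∀ x ∈ B', ∀ y ∉ B, δ ≤ ρ x y) {A : ℝ} (hA : 0 < A) :
    ∃ C : ℝ, 0 < C ∧ ∀ (r : ℝ), 0 ≤ r → ∀ (n : ℕ) (f : X → ℝ) (m : SignedMeasure X),
      (∀ y, |sigma φ ev H (2 ^ n) f m y| ≤ A * r * ((2 : ℝ) ^ n) ^ α) → ∀ x ∈ B',
      |sigma φ ev H (2 ^ n) f m x - sigmaQuant φ ev H S (2 ^ n) f m (ν n) B x| ≤
        C * (r + 1) * ((2 : ℝ) ^ n) ^ (-s) := by
  obtain ⟨C₁, hC₁, hL1⟩ := hX.exists_lintegral_filterKernel_le hH (K := 2 * K) (by linarith) hM.le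
  obtain ⟨C₂, hC₂, hmass⟩ := hX.exists_measure_univ_le hK hM
  set Q := ⌈2 * α + s⌉₊ with hQ
  obtain ⟨C₃, hC₃, hloc⟩ := hX.filterKernel_localized hH Q
  set D : ℝ := A * (C₃ * 2 ^ α / (2 * δ) ^ Q) * C₂ with hD
  have hD0 : 0 < D := by positivity
  refine ⟨D + C₁, by positivity, fun r hr n f m hP x hx => ?_⟩
  set N : ℝ := 2 ^ n with hN
  have hN1 : 1 ≤ N := one_le_pow₀ one_le_two
  have hN0 : 0 < N := by linarith
  have hNα : 0 < N ^ α := Real.rpow_pos_of_pos hN0 _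
  have hNs : 0 < N ^ (-s) := Real.rpow_pos_of_pos hN0 _
  have hfar : ∀ y ∈ Bᶜ, |filterKernel φ ev H (2 * N) x y| ≤
      C₃ * 2 ^ α / (2 * δ) ^ Q * (N ^ α / N ^ Q) := by
    intro y hy
    have h1 := hloc (2 * N) (by linarith) x y
    rw [Real.mul_rpow (by norm_num) hN0.le] at h1
    have h2 : (2 * N * δ) ^ Q * |filterKernel φ ev H (2 * N) x y| ≤ C₃ * (2 ^ α * N ^ α) := by
      refine le_trans ?_ h1
      gcongr
      exact hsep x hx y hy
    have h3 : C₃ * 2 ^ α / (2 * δ) ^ Q * (N ^ α / N ^ Q) =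
        C₃ * (2 ^ α * N ^ α) / (2 * N * δ) ^ Q := by
      rw [show 2 * N * δ = 2 * δ * N by ring, mul_pow (2 * δ) N]
      field_simp
    rw [h3, le_div_iff₀ (by positivity)]
    linarith
  have hpow : N ^ α * (N ^ α / N ^ Q) ≤ N ^ (-s) := by
    rw [← Real.rpow_natCast, ← Real.rpow_sub hN0, ← Real.rpow_add hN0]
    apply Real.rpow_le_rpow_of_exponent_le hN1
    have : 2 * α + s ≤ Q := Nat.le_ceil _
    linarith
  have hrep : ∀ g ∈ diffPoly φ ev N, sigma φ ev H (2 * N) g (ν n) = g := fun g hg =>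
    hX.sigma_eq_self hH ha (hν n) (by positivity) le_rfl (by
      rwa [mul_div_cancel_left₀ _ two_ne_zero])
  have key := hX.enorm_sigma_sub_sigmaQuant_le hH hN0 hrep S f m hB x
  have h1 : ∫⁻ y in Bᶜ, ‖sigma φ ev H N f m y‖ₑ * ‖filterKernel φ ev H (2 * N) x y‖ₑ
      ∂(ν n).variation ≤ ENNReal.ofReal (D * r * N ^ (-s)) := by
    calc ∫⁻ y in Bᶜ, ‖sigma φ ev H N f m y‖ₑ * ‖filterKernel φ ev H (2 * N) x y‖ₑ ∂(ν n).variation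
        ≤ ∫⁻ _ in Bᶜ, ENNReal.ofReal (A * r * N ^ α *
            (C₃ * 2 ^ α / (2 * δ) ^ Q * (N ^ α / N ^ Q))) ∂(ν n).variation := by
          refine setLIntegral_mono' hB.compl fun y hy => ?_
          rw [Real.enorm_eq_ofReal_abs, Real.enorm_eq_ofReal_abs,
            ← ENNReal.ofReal_mul (abs_nonneg _)]
          apply ENNReal.ofReal_le_ofReal
          gcongr
          · exact hP y
          · exact hfar y hy
      _ ≤ ENNReal.ofReal (A * r * N ^ α * (C₃ * 2 ^ α / (2 * δ) ^ Q * (N ^ α / N ^ Q))) *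
            ENNReal.ofReal C₂ := by
          rw [setLIntegral_const]
          gcongr
          exact (measure_mono (Set.subset_univ _)).trans (hmass N hN1 _ (hreg n))
      _ ≤ _ := by
          rw [← ENNReal.ofReal_mul (by positivity)]
          apply ENNReal.ofReal_le_ofReal
          calc A * r * N ^ α * (C₃ * 2 ^ α / (2 * δ) ^ Q * (N ^ α / N ^ Q)) * C₂
              = D * r * (N ^ α * (N ^ α / N ^ Q)) := by rw [hD]; ring
            _ ≤ _ := by gcongr
  have h2 : ENNReal.ofReal (N ^ (-S)) *
      ∫⁻ y, ‖filterKernel φ ev H (2 * N) x y‖ₑ ∂(ν n).variation ≤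
      ENNReal.ofReal (C₁ * N ^ (-s)) := by
    calc _ ≤ ENNReal.ofReal (N ^ (-s)) * ENNReal.ofReal C₁ := by
          gcongr
          exact hL1 (2 * N) (by linarith) _ (hreg n).two_mul x
      _ = _ := by rw [← ENNReal.ofReal_mul hNs.le, mul_comm]
  have h3 := key.trans (add_le_add h1 h2)
  rw [Real.enorm_eq_ofReal_abs, ← ENNReal.ofReal_add (by positivity) (by positivity),
    ENNReal.ofReal_le_ofReal_iff (by positivity)] at h3
  refine h3.trans ?_
  have h4 : 0 ≤ D * N ^ (-s) := by positivity
  have h5 : 0 ≤ C₁ * r * N ^ (-s) := by positivity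
  nlinarith

end Diffusion

/-- An integer bounded by `A · 2^(n σ) + 1` fits into a word of length linear in `n`. -/
theorem fitsInBits_of_abs_le {A : ℝ} (σ n : ℕ) {z : ℤ}
    (hz : |(z : ℝ)| ≤ A * ((2 : ℝ) ^ n) ^ σ + 1) :
    FitsInBits (n * σ + ⌈2 * A + 2⌉₊) z := by
  have h1 : 2 * A + 2 < (2 : ℝ) ^ ⌈2 * A + 2⌉₊ := by
    refine (Nat.le_ceil _).trans_lt ?_
    exact_mod_cast Nat.lt_two_pow_self
  have h2 : (1 : ℝ) ≤ (2 ^ n) ^ σ := one_le_pow₀ (one_le_pow₀ one_le_two)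
  have h3 : 2 * |(z : ℝ)| < 2 ^ (n * σ + ⌈2 * A + 2⌉₊) := by
    rw [pow_add, pow_mul]
    calc 2 * |(z : ℝ)| ≤ (2 ^ n) ^ σ * (2 * A + 2) := by nlinarith
      _ < _ := by gcongr
  have h4 : 2 * |z| < 2 ^ (n * σ + ⌈2 * A + 2⌉₊) := by exact_mod_cast h3
  constructor
  · linarith [neg_abs_le z]
  · linarith [le_abs_self z]

/-- Comparison of `N^α (1 + log N)` with the bound in terms of `r / ε`. -/
theorem exists_bit_bound {α s c : ℝ} (hs : 0 < s) (hc : 0 < c) :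
    ∃ C : ℝ, 0 < C ∧ ∀ (r : ℝ), 0 < r → ∀ (n : ℕ) (ε : ℝ), c * r * ((2 : ℝ) ^ n) ^ (-s) = ε →
      ε ≤ r → ((2 : ℝ) ^ n) ^ α * (n + 1) ≤ C * (r / ε) ^ (α / s) * (1 + Real.logb 2 (r / ε)) := by
  refine ⟨c ^ (α / s) * (1 + (1 + |Real.logb 2 c|) / s), by positivity,
    fun r hr n ε hε hεr => ?_⟩
  have hN0 : (0 : ℝ) < 2 ^ n := by positivity
  have hNs : 0 < ((2 : ℝ) ^ n) ^ s := by positivity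
  have hε0 : 0 < ε := by rw [← hε]; positivity
  have hq : r / ε = ((2 : ℝ) ^ n) ^ s / c := by
    rw [← hε, Real.rpow_neg hN0.le]
    field_simp
  have h1 : 1 ≤ r / ε := (one_le_div hε0).2 hεr
  have hu : 0 ≤ Real.logb 2 (r / ε) := Real.logb_nonneg one_lt_two h1
  have hpow : (r / ε) ^ (α / s) = ((2 : ℝ) ^ n) ^ α / c ^ (α / s) := by
    rw [hq, Real.div_rpow hNs.le hc.le, ← Real.rpow_mul hN0.le]
    congr 2
    field_simp
  have hlog : Real.logb 2 (r / ε) = n * s - Real.logb 2 c := by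
    rw [hq, Real.logb_div hNs.ne' hc.ne', Real.logb_rpow_eq_mul_logb_of_pos hN0, Real.logb_pow,
      Real.logb_self_eq_one one_lt_two]
    ring
  have hn : (n : ℝ) + 1 ≤ (1 + (1 + |Real.logb 2 c|) / s) * (1 + Real.logb 2 (r / ε)) := by
    have h2 : (n : ℝ) = (Real.logb 2 (r / ε) + Real.logb 2 c) / s := by
      rw [hlog]; field_simp; ring
    set u := Real.logb 2 (r / ε) with hudef
    have h3 : (u + Real.logb 2 c) / s ≤ (u + |Real.logb 2 c|) / s := by
      gcongr
      exact le_abs_self _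
    have h4 : (1 + (1 + |Real.logb 2 c|) / s) * (1 + u) - ((u + |Real.logb 2 c|) / s + 1) =
        u + (1 + u * |Real.logb 2 c|) / s := by
      field_simp
      ring
    have h5 : 0 ≤ (1 + u * |Real.logb 2 c|) / s := by positivity
    rw [h2]
    linarith
  have hcα : 0 < c ^ (α / s) := by positivity
  calc ((2 : ℝ) ^ n) ^ α * (n + 1)
      ≤ ((2 : ℝ) ^ n) ^ α * ((1 + (1 + |Real.logb 2 c|) / s) * (1 + Real.logb 2 (r / ε))) := by
        gcongr
    _ = _ := by
        rw [hpow]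
        field_simp

end

end DiffusionSpace

theorem theorem6p3 {X : Type*} [TopologicalSpace X] [MeasurableSpace X] [BorelSpace X]
    (ρ : X → X → ℝ) (μ : Measure X) [IsProbabilityMeasure μ]
    (φ : ℕ → X → ℝ) (ev : ℕ → ℝ) (α : ℝ)
    (hX : DiffusionSpace.IsDiffusionMeasureSpace ρ μ φ ev α)
    (a : ℝ) (ha : DiffusionSpace.StrongProduct φ ev a)
    (hcut : DiffusionSpace.SmoothCutoff ρ μ φ ev)
    (p : ℝ≥0∞) (hp : 1 ≤ p)
    (μs : ℕ → SignedMeasure X)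
    (hμs_top : p = ∞ → DiffusionSpace.IsUniformMZQuadrature μ φ ev a p μs)
    (hμs_lt : p ≠ ∞ → ∀ n, μs n = μ.toSignedMeasure)
    (νs : ℕ → SignedMeasure X)
    (hνs : DiffusionSpace.IsUniformMZQuadrature μ φ ev a p νs)
    (hνs_supp : DiffusionSpace.SupportGrowth α νs)
    (H : ℝ → ℝ) (hH : DiffusionSpace.IsLowPass H)
    (x₀ : X) (R' R : ℝ) (hR' : 0 < R') (hR : 0 < R) (B' B : Set X)
    (hB' : B' = DiffusionSpace.qBall ρ x₀ R') (hB : B = DiffusionSpace.qBall ρ x₀ R)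
    (hBB : B' ⊂ B)
    (s S : ℝ) (hs : 0 < s) (hS : max 1 s < S)
    (r₀ : ℝ) (hr₀ : 0 < r₀) :
    ∃ c : ℝ, 0 < c ∧
      (∀ r : ℝ, r₀ ≤ r → ∀ n : ℕ,
        ∀ f ∈ DiffusionSpace.localSobolevBall μ φ ev H μs s p B r,
          eLpNorm (f - DiffusionSpace.sigmaQuant φ ev H S (2 ^ n) f (μs n) (νs n) B) p
            (μ.restrict B') ≤ ENNReal.ofReal (c * r * ((2 : ℝ) ^ n) ^ (-s))) ∧
      ∃ C : ℝ, 0 < C ∧ ∀ r : ℝ, 0 < r → ∀ (n : ℕ) (ε : ℝ),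
        c * r * ((2 : ℝ) ^ n) ^ (-s) = ε → ε ≤ 1 → ε ≤ r →
          ∃ L : ℕ, DiffusionSpace.RepresentableWithBits ((νs n).variation.support ∩ B)
              ((fun f => DiffusionSpace.quantized φ ev H S (2 ^ n) f (μs n)) ''
                DiffusionSpace.localSobolevBall μ φ ev H μs s p B r) L ∧
            (L : ℝ) ≤ C * (r / ε) ^ (α / s) * (1 + Real.logb 2 (r / ε)) := by
  have hsS : s < S := (le_max_right _ _).trans_lt hS
  have hBm : MeasurableSet B := hB ▸ hX.measurableSet_qBall x₀ hR
  have hB'm : MeasurableSet B' := hB' ▸ hX.measurableSet_qBall x₀ hR'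
  have hB'c : IsCompact B' := hB' ▸ hX.compact_ball x₀ R' hR'
  obtain ⟨hquad, C₀, hC₀, hsamp⟩ := hX.exists_isSamplingFamily hH ha hp hμs_top hμs_lt
  obtain ⟨K, M, hK, hM, hreg⟩ :=
    hX.exists_isRegularMeasure_of_isUniformMZQuadrature hH ha hp hνs
  obtain ⟨ψ, hψ, hψ1, hψ0⟩ := hcut x₀ R' R hR' hR (by rwa [← hB', ← hB])
  obtain ⟨δ, hδ, hsep⟩ := hX.exists_separation hψ.1 hB'c (by rwa [hB']) (B := B) (by rwa [hB])
  obtain ⟨A, hA, hP⟩ := hX.exists_abs_sigma_le hH hC₀ hsamp s B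
  obtain ⟨C₁, hC₁, hquant⟩ := hX.exists_abs_sigma_sub_sigmaQuant_le hH ha hνs.quadrature hK hM hreg
    hsS.le hBm hδ hsep hA
  have h2s : (2 : ℝ) ^ (-s) < 1 := Real.rpow_lt_one_of_one_lt_of_neg one_lt_two (by linarith)
  have hgeom : 0 < 1 / (1 - (2 : ℝ) ^ (-s)) := one_div_pos.2 (by linarith)
  set c := 1 / (1 - (2 : ℝ) ^ (-s)) + C₁ * (1 + 1 / r₀) with hc
  have hc0 : 0 < c := by positivity
  refine ⟨c, hc0, fun r hr n f hf => ?_, ?_⟩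
  · have hr0 : 0 < r := hr₀.trans_le hr
    set P := DiffusionSpace.sigma φ ev H (2 ^ n) f (μs n) with hPdef
    set q := DiffusionSpace.sigmaQuant φ ev H S (2 ^ n) f (μs n) (νs n) B with hq
    have hPm : AEStronglyMeasurable P μ :=
      (hX.continuous_sigma hH (by positivity) _ _).aestronglyMeasurable
    have hqm : AEStronglyMeasurable q μ :=
      (hX.continuous_sigmaQuant hH (by positivity) S _ _ _ _).aestronglyMeasurable
    have hfm : AEStronglyMeasurable f μ := hf.1.1.1
    have h1 : eLpNorm (f - P) p (μ.restrict B') ≤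
        ENNReal.ofReal (1 / (1 - 2 ^ (-s)) * r * ((2 : ℝ) ^ n) ^ (-s)) :=
      (eLpNorm_mono_measure _ (Measure.restrict_mono hBB.subset le_rfl)).trans
        (hX.eLpNorm_sub_sigma_le hH ha hp hquad hsamp hs hr0.le hf n)
    have h2 : eLpNorm (P - q) p (μ.restrict B') ≤
        ENNReal.ofReal (C₁ * (r + 1) * ((2 : ℝ) ^ n) ^ (-s)) := by
      have hae : ∀ᵐ x ∂μ.restrict B', ‖(P - q) x‖ ≤ C₁ * (r + 1) * ((2 : ℝ) ^ n) ^ (-s) := by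
        refine (ae_restrict_iff' hB'm).2 (ae_of_all _ fun x hx => ?_)
        exact hquant r hr0.le n f (μs n) (hP r hr0.le f hf n) x hx
      refine (eLpNorm_le_of_ae_bound hae).trans (mul_le_of_le_one_left' ?_)
      refine ENNReal.rpow_le_one ?_ (by positivity)
      rw [Measure.restrict_apply_univ]
      exact prob_le_one
    have e : f - q = (f - P) + (P - q) := by abel
    rw [e]
    calc eLpNorm ((f - P) + (P - q)) p (μ.restrict B')
        ≤ eLpNorm (f - P) p (μ.restrict B') + eLpNorm (P - q) p (μ.restrict B') :=
          eLpNorm_add_le ((hfm.sub hPm).mono_measure Measure.restrict_le_self)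
            ((hPm.sub hqm).mono_measure Measure.restrict_le_self) hp
      _ ≤ ENNReal.ofReal (1 / (1 - 2 ^ (-s)) * r * ((2 : ℝ) ^ n) ^ (-s)) +
          ENNReal.ofReal (C₁ * (r + 1) * ((2 : ℝ) ^ n) ^ (-s)) := add_le_add h1 h2
      _ ≤ _ := by
          rw [← ENNReal.ofReal_add (by positivity) (by positivity)]
          apply ENNReal.ofReal_le_ofReal
          have h3 : r + 1 ≤ (1 + 1 / r₀) * r := by
            have : 1 ≤ r / r₀ := (one_le_div hr₀).2 hr
            have e : (1 + 1 / r₀) * r = r + r / r₀ := by ring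
            linarith
          rw [← add_mul]
          gcongr
          calc 1 / (1 - 2 ^ (-s)) * r + C₁ * (r + 1)
              ≤ 1 / (1 - 2 ^ (-s)) * r + C₁ * ((1 + 1 / r₀) * r) := by gcongr
            _ = c * r := by rw [hc]; ring
  · obtain ⟨C₂, hC₂, hgrowth⟩ := hνs_supp
    obtain ⟨C₃, hC₃, hbit⟩ := DiffusionSpace.exists_bit_bound (α := α) hs hc0
    set σ := ⌈S + α + s⌉₊ with hσ
    set b := ⌈2 * (A / c) + 2⌉₊ with hb
    refine ⟨C₂ * (σ + b + 1) * C₃, by positivity, fun r hr n ε hε hε1 hεr => ?_⟩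
    obtain ⟨hfin, hcard⟩ := hgrowth n
    have hN1 : (1 : ℝ) ≤ 2 ^ n := one_le_pow₀ one_le_two
    have hN0 : (0 : ℝ) < 2 ^ n := by positivity
    refine ⟨((νs n).variation.support ∩ B).ncard * (n * σ + b),
      ⟨hfin.subset Set.inter_subset_left, n * σ + b, ?_, le_rfl⟩, ?_⟩
    · rintro _ ⟨f, hf, rfl⟩ y -
      refine DiffusionSpace.fitsInBits_of_abs_le σ n ?_
      have hr1 : r ≤ ((2 : ℝ) ^ n) ^ s / c := by
        rw [← hε, Real.rpow_neg hN0.le, ← div_eq_mul_inv, div_le_one (by positivity)] at hε1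
        rw [le_div_iff₀ hc0]
        linarith
      have hfl : ∀ v : ℝ, |((⌊v⌋ : ℤ) : ℝ)| ≤ |v| + 1 := by
        intro v
        have h1 := Int.floor_le v
        have h2 := Int.lt_floor_add_one v
        rw [abs_le]
        constructor <;> [linarith [neg_abs_le v]; linarith [le_abs_self v]]
      refine (hfl _).trans ?_
      gcongr
      have hSpos : 0 < ((2 : ℝ) ^ n) ^ S := by positivity
      rw [abs_mul, abs_of_pos hSpos]
      calc ((2 : ℝ) ^ n) ^ S * |DiffusionSpace.sigma φ ev H (2 ^ n) f (μs n) y|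
          ≤ ((2 : ℝ) ^ n) ^ S * (A * (((2 : ℝ) ^ n) ^ s / c) * ((2 : ℝ) ^ n) ^ α) := by
            gcongr
            refine (hP r hr.le f hf n y).trans ?_
            gcongr
        _ = A / c * ((2 : ℝ) ^ n) ^ (S + α + s) := by
            rw [Real.rpow_add hN0, Real.rpow_add hN0]
            ring
        _ ≤ A / c * ((2 : ℝ) ^ n) ^ σ := by
            gcongr
            rw [← Real.rpow_natCast _ σ]
            exact Real.rpow_le_rpow_of_exponent_le hN1 (Nat.le_ceil _)
    · have hcard' : (((νs n).variation.support ∩ B).ncard : ℝ) ≤ C₂ * ((2 : ℝ) ^ n) ^ α := by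
        refine le_trans ?_ hcard
        exact_mod_cast Set.ncard_le_ncard Set.inter_subset_left hfin
      push_cast
      calc (((νs n).variation.support ∩ B).ncard : ℝ) * (n * σ + b)
          ≤ C₂ * ((2 : ℝ) ^ n) ^ α * ((σ + b + 1) * (n + 1)) := by
            gcongr
            have h1 : (0 : ℝ) ≤ n := Nat.cast_nonneg n
            have h2 : (0 : ℝ) ≤ σ := Nat.cast_nonneg σ
            have h3 : (0 : ℝ) ≤ b := Nat.cast_nonneg b
            nlinarith
        _ = C₂ * (σ + b + 1) * (((2 : ℝ) ^ n) ^ α * (n + 1)) := by ring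
        _ ≤ C₂ * (σ + b + 1) * (C₃ * (r / ε) ^ (α / s) * (1 + Real.logb 2 (r / ε))) := by
            exact mul_le_mul_of_nonneg_left (hbit r hr n ε hε hεr) (by positivity)
        _ = _ := by ring
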